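/- Let $\varepsilon,\mu:\mathbf R\to(0,\infty)$ be piecewise continuous (finitely many discontinuities in each bounded interval, finite one-sided limits everywhere), periodic with period $1$, and inversion symmetric: $\varepsilon(-x)=\varepsilon(x)$ and $\mu(-x)=\mu(x)$ for all $x$. Let $$\mathcal L\psi=-\frac1{\varepsilon(x)}\frac{d}{dx}\Big(\frac1{\mu(x)}\frac{d\psi}{dx}\Big).$$ For $k\in[-\pi,\pi]$ and $E\in\mathbf R$, a Bloch mode at $(k,E)$ is a function $\psi:\mathbf R\to\mathbf C$, $\psi\not\equiv0$, with $\psi$ and $\frac1\mu\psi'$ continuous, $\mathcal L\psi=E\psi$ and $\psi(x+1)=e^{ik}\psi(x)$ on $\mathbf R$. Let $E_1(k)\le E_2(k)\le\cdots$ be the values $E$ for which Bloch modes at $(k,E)$ exist, repeated according to multiplicity, and set $$E_j^-=\min_{k\in[-\pi,\pi]}E_j(k),\qquad E_j^+=\max_{k\in[-\pi,\pi]}E_j(k).$$ Let $j\ge1$ and assume that the $j$-th band is isolated, i.e. $E_j^+<E_{j+1}^-$ and, if $j\ge2$, also $E_{j-1}^+<E_j^-$. Then there is $k\in\{0,\pi\}$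 with $E_j(k)=E_j^+$ and $E_{j+1}(k)=E_{j+1}^-$, so that there are Bloch modes both at $(k,E_j^+)$ and at $(k,E_{j+1}^-)$. Moreover, whenever $k\in\{0,\pi\}$, $\varphi_1$ is a Bloch mode at $(k,E_j^+)$ and $\varphi_2$ is a Bloch mode at $(k,E_{j+1}^-)$, one of $\varphi_1,\varphi_2$ is an even function on $\mathbf R$ and the other one is an odd function. -/

import Mathlib

open Set Filter Topology

noncomputable section

namespace Photonic

/-- `f` is piecewise continuous on the real line: finitely many discontinuities in every bounded
interval, and finite one-sided limits at every point. -/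
def PiecewiseContinuous (f : ℝ → ℝ) : Prop :=
  (∀ a b : ℝ, {x | x ∈ Icc a b ∧ ¬ ContinuousAt f x}.Finite) ∧
    ∀ x : ℝ, (∃ l : ℝ, Tendsto f (𝓝[<] x) (𝓝 l)) ∧ ∃ r : ℝ, Tendsto f (𝓝[>] x) (𝓝 r)

/-- `ψ` solves `-(1/ε) ((1/μ) ψ')' = E ψ` on the real line: `ψ` and its flux `v = (1/μ) ψ'` are
continuous, and the equation holds classically wherever both coefficients are continuous
(there `ψ' = μ v` and `v' = - E ε ψ`). -/
def SolvesEigenEquation (ε μ : ℝ → ℝ) (E : ℝ) (ψ : ℝ → ℂ) : Prop :=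
  Continuous ψ ∧ ∃ v : ℝ → ℂ, Continuous v ∧
    ∀ x : ℝ, ContinuousAt ε x → ContinuousAt μ x →
      HasDerivAt ψ ((μ x : ℂ) * v x) x ∧ HasDerivAt v (-((E : ℂ) * (ε x : ℂ) * ψ x)) x

/-- The eigenspace of the Floquet-Bloch problem with wavenumber `k` for the value `E`: all
solutions of the eigenvalue equation with `ψ (x + 1) = e^{ik} ψ x` (zero included). -/
def blochSpace (ε μ : ℝ → ℝ) (k E : ℝ) : Submodule ℂ (ℝ → ℂ) where
  carrier := {ψ | SolvesEigenEquation ε μ E ψ ∧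
    ∀ x : ℝ, ψ (x + 1) = Complex.exp (Complex.I * (k : ℂ)) * ψ x}
  zero_mem' := by
    refine ⟨⟨continuous_const, fun _ => 0, continuous_const, fun x _ _ => ⟨?_, ?_⟩⟩, ?_⟩
    · rw [mul_zero]; exact hasDerivAt_const x (0 : ℂ)
    · simp only [Pi.zero_apply, mul_zero, neg_zero]; exact hasDerivAt_const x (0 : ℂ)
    · simp
  add_mem' := by
    rintro φ ψ ⟨⟨hφ, v, hv, h1⟩, p1⟩ ⟨⟨hψ, w, hw, h2⟩, p2⟩
    refine ⟨⟨hφ.add hψ, v + w, hv.add hw, fun x he hm => ⟨?_, ?_⟩⟩, fun x => ?_⟩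
    · exact ((h1 x he hm).1.add (h2 x he hm).1).congr_deriv (by simp only [Pi.add_apply]; ring)
    · exact ((h1 x he hm).2.add (h2 x he hm).2).congr_deriv (by simp only [Pi.add_apply]; ring)
    · simp only [Pi.add_apply, p1, p2]; ring
  smul_mem' := by
    rintro c φ ⟨⟨hφ, v, hv, h1⟩, p1⟩
    refine ⟨⟨hφ.const_smul c, c • v, hv.const_smul c, fun x he hm => ⟨?_, ?_⟩⟩, fun x => ?_⟩
    · exact ((h1 x he hm).1.const_smul c).congr_deriv
        (by simp only [Pi.smul_apply, smul_eq_mul]; ring)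
    · exact ((h1 x he hm).2.const_smul c).congr_deriv
        (by simp only [Pi.smul_apply, smul_eq_mul]; ring)
    · simp only [Pi.smul_apply, smul_eq_mul, p1]; ring

/-- A Bloch mode at `(k, E)`: an eigenfunction of the Floquet-Bloch problem. -/
def IsBlochMode (ε μ : ℝ → ℝ) (k E : ℝ) (φ : ℝ → ℂ) : Prop :=
  φ ∈ blochSpace ε μ k E ∧ φ ≠ 0

/-- The number of eigenvalues `≤ E` of the Floquet-Bloch problem with wavenumber `k`, counted with
multiplicity: an eigenvalue `e` contributes the pairs `(e, i)` with `i` less than the dimension of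
its eigenspace. -/
def eigenvalueCount (ε μ : ℝ → ℝ) (k E : ℝ) : ℕ∞ :=
  {p : ℝ × ℕ | p.1 ≤ E ∧ p.2 < Module.finrank ℂ (blochSpace ε μ k p.1)}.encard

/-- The dispersion relation `E_j(k)`, for `j ≥ 1`: the `j`-th smallest eigenvalue of the
Floquet-Bloch problem with wavenumber `k`, counted with multiplicity. -/
def bandEnergy (ε μ : ℝ → ℝ) (j : ℕ) (k : ℝ) : ℝ :=
  sInf {E : ℝ | (j : ℕ∞) ≤ eigenvalueCount ε μ k E}

/-- The lower edge `E_j^-` of the `j`-th band. -/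
def bandMin (ε μ : ℝ → ℝ) (j : ℕ) : ℝ :=
  sInf (bandEnergy ε μ j '' Icc (-Real.pi) Real.pi)

/-- The upper edge `E_j^+` of the `j`-th band. -/
def bandMax (ε μ : ℝ → ℝ) (j : ℕ) : ℝ :=
  sSup (bandEnergy ε μ j '' Icc (-Real.pi) Real.pi)

/-- The `j`-th band (`j ≥ 1`) is isolated. The first band has no lower neighbour. -/
def IsIsolatedBand (ε μ : ℝ → ℝ) (j : ℕ) : Prop :=
  (2 ≤ j → bandMax ε μ (j - 1) < bandMin ε μ j) ∧ bandMax ε μ j < bandMin ε μ (j + 1)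

end Photonic

end

/-! Write the equation as a first-order system for a solution and its flux, and let p, -r and q, s
be the values at x = 1/2 of the solution and flux of the even and the odd fundamental solution
(`cosSolution ε μ E` and `sinSolution μ ε E`). Constancy of the Wronskian gives ps + qr = 1. By
inversion symmetry the monodromy matrix over a period is determined by these four numbers: its
diagonal entries are both Δ = ps - qr, and its off-diagonal entries are 2qs and -2pr
(`cosSolution_add_one`, `sinSolution_add_one`). A Bloch mode requires Δ(E) = cos k. When sin k = 0
the diagonal of M - e^{ik} then vanishes, so 2qs ≠ 0 forces the mode to be even and 2pr ≠ 0 forces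
it to be odd (`IsBlochMode.even`, `IsBlochMode.odd`).

Let θ and φ be continuous polar angles of (p, r) and (s, q) as functions of E. The Wronskian of
solutions for two energies shows that both increase strictly; also |θ - φ| < π/2 and Δ = cos(θ +
φ)/cos(θ - φ) (`exists_isAnglePair`). Hence |Δ| ≤ 1 exactly when both angles lie in a common closed
quadrant [iπ/2, (i+1)π/2], and while they do (-1)^i Δ decreases strictly from 1 to -1
(`signed_discriminant_lt`, `exists_isNthEnergy`). Thus E_{i+1}(k) is the unique E with both angles
in quadrant i and Δ(E) = cos k, and multiplicities agree (`encard_isNthEnergy`, `bandEnergy_eq`).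

For cos k = (-1)^j, the edges E_j^+ and E_{j+1}^- are the energies at which the larger, respectively
the smaller, of the two angles equals jπ/2. If the gap is open, strict monotonicity prevents the
same angle from being on the axis at both edges. So θ is there at one edge and φ at the other, and
the parities differ. -/

noncomputable section

namespace Photonic

open MeasureTheory
open scoped Interval

/-! ### Coefficients and their primitives. -/

/-- The properties of a material coefficient that the integral equation needs. -/
structure IsCoefficient (w : ℝ → ℝ) : Prop where
  bounded : ∃ K : ℝ, 0 ≤ K ∧ ∀ x, |w x| ≤ K
  aestronglyMeasurable : AEStronglyMeasurable w volume
  countable : {x | ¬ ContinuousAt w x}.Countable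

lemma PiecewiseContinuous.countable {f : ℝ → ℝ} (hf : PiecewiseContinuous f) :
    {x | ¬ ContinuousAt f x}.Countable := by
  have h : {x | ¬ ContinuousAt f x} ⊆
      ⋃ n : ℕ, {x | x ∈ Icc (-(n : ℝ)) n ∧ ¬ ContinuousAt f x} := by
    intro x hx
    obtain ⟨n, hn⟩ := exists_nat_ge |x|
    exact mem_iUnion.2 ⟨n, abs_le.1 hn, hx⟩
  exact (countable_iUnion fun n => (hf.1 _ _).countable).mono h

lemma aestronglyMeasurable_of_countable {f : ℝ → ℝ}
    (hf : {x | ¬ ContinuousAt f x}.Countable) : AEStronglyMeasurable f volume := by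
  have hc : ContinuousOn f {x | ¬ ContinuousAt f x}ᶜ := fun x hx =>
    (not_not.1 hx : ContinuousAt f x).continuousWithinAt
  have h := hc.aestronglyMeasurable (μ := volume) hf.measurableSet.compl
  rwa [Measure.restrict_eq_self_of_ae_mem] at h
  exact compl_mem_ae_iff.2 (hf.measure_zero _)

/-- One-sided limits bound `f` near each point, compactness bounds it on one period, and periodicity
carries the bound to the line. -/
lemma PiecewiseContinuous.isCoefficient {f : ℝ → ℝ} (hf : PiecewiseContinuous f)
    (hper : ∀ x, f (x + 1) = f x) : IsCoefficient f := by
  refine ⟨?_, aestronglyMeasurable_of_countable hf.countable, hf.countable⟩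
  have hloc : ∃ K : ℝ, ∀ x ∈ Icc (0 : ℝ) 1, |f x| ≤ K := by
    refine isCompact_Icc.induction_on (p := fun s => ∃ K : ℝ, ∀ x ∈ s, |f x| ≤ K)
      ⟨0, by simp⟩ (fun s t hst ⟨K, hK⟩ => ⟨K, fun x hx => hK x (hst hx)⟩)
      (fun s t ⟨K, hK⟩ ⟨L, hL⟩ => ⟨max K L, ?_⟩) (fun x _ => ?_)
    · rintro x (hx | hx)
      exacts [(hK x hx).trans (le_max_left _ _), (hL x hx).trans (le_max_right _ _)]
    · obtain ⟨⟨l, hl⟩, r, hr⟩ := hf.2 x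
      refine ⟨{y | |f y| ≤ max (max (|l| + 1) (|r| + 1)) |f x|}, mem_nhdsWithin_of_mem_nhds ?_,
        _, fun y hy => hy⟩
      have h1 : ∀ᶠ y in 𝓝[<] x, |f y| ≤ max (max (|l| + 1) (|r| + 1)) |f x| := by
        filter_upwards [hl.abs.eventually_le_const (lt_add_one |l|)] with y hy
        exact hy.trans ((le_max_left _ _).trans (le_max_left _ _))
      have h2 : ∀ᶠ y in 𝓝[>] x, |f y| ≤ max (max (|l| + 1) (|r| + 1)) |f x| := by
        filter_upwards [hr.abs.eventually_le_const (lt_add_one |r|)] with y hy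
        exact hy.trans ((le_max_right _ _).trans (le_max_left _ _))
      have h3 : ∀ᶠ y in 𝓝[≠] x, |f y| ≤ max (max (|l| + 1) (|r| + 1)) |f x| := by
        rw [← Iio_union_Ioi, nhdsWithin_union]
        exact eventually_sup.2 ⟨h1, h2⟩
      rw [eventually_nhdsWithin_iff] at h3
      filter_upwards [h3] with y hy
      by_cases hyx : y = x
      · subst hyx; exact le_max_right _ _
      · exact hy hyx
  obtain ⟨K, hK⟩ := hloc
  refine ⟨K, (abs_nonneg _).trans (hK 0 (by simp)), fun x => ?_⟩
  have hp : Function.Periodic f 1 := hper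
  have : f x = f (Int.fract x) := by
    have := hp.sub_int_mul_eq ⌊x⌋ (x := x)
    rw [mul_one] at this
    exact this.symm
  rw [this]
  exact hK _ ⟨Int.fract_nonneg x, (Int.fract_lt_one x).le⟩

namespace IsCoefficient

variable {w : ℝ → ℝ}

lemma aesm_mul (hw : IsCoefficient w) {f : ℝ → ℝ} (hf : Continuous f) :
    AEStronglyMeasurable (fun t => w t * f t) volume :=
  hw.aestronglyMeasurable.mul hf.aestronglyMeasurable

lemma intervalIntegrable_mul (hw : IsCoefficient w) {f : ℝ → ℝ} (hf : Continuous f) (a b : ℝ) :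
    IntervalIntegrable (fun t => w t * f t) volume a b := by
  obtain ⟨K, hK, hb⟩ := hw.bounded
  refine ((continuous_const.mul hf.abs : Continuous fun t => K * |f t|).intervalIntegrable
    a b).mono_fun' (hw.aesm_mul hf).restrict (Eventually.of_forall fun t => ?_)
  change |w t * f t| ≤ K * |f t|
  rw [abs_mul]
  exact mul_le_mul_of_nonneg_right (hb t) (abs_nonneg _)

/-- Joint continuity in parameter and endpoint is what later makes the solutions, overlaps and
angles continuous in the energy. The dominating constant comes from compactness of an interval
around 0 and the endpoint. -/
lemma continuous_parametric_primitive (hw : IsCoefficient w) {X : Type*} [TopologicalSpace X]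
    [FirstCountableTopology X] {g : X → ℝ → ℝ} (hg : Continuous (Function.uncurry g)) :
    Continuous fun p : X × ℝ => ∫ t in (0 : ℝ)..p.2, w t * g p.1 t := by
  obtain ⟨K, hK, hb⟩ := hw.bounded
  rw [continuous_iff_continuousAt]
  rintro ⟨q, b₀⟩
  obtain ⟨a, ha⟩ := exists_lt (min 0 b₀)
  obtain ⟨b, hb'⟩ := exists_gt (max 0 b₀)
  rw [lt_min_iff] at ha
  rw [max_lt_iff] at hb'
  have hgq : ∀ x, Continuous (g x) := fun x => hg.comp (Continuous.prodMk_right x)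
  obtain ⟨M, hM⟩ := (isCompact_Icc (a := a) (b := b)).exists_bound_of_continuousOn
    (hgq q).continuousOn
  have hev : ∀ᶠ x in 𝓝 q, ∀ t ∈ Icc a b, |g x t| < M + 1 := by
    refine isCompact_Icc.eventually_forall_of_forall_eventually fun t ht => ?_
    have h := (hg.abs.tendsto (q, t)).eventually_lt_const
      (show |Function.uncurry g (q, t)| < M + 1 from (hM t ht).trans_lt (lt_add_one M))
    exact h
  have hab : a ≤ b := by linarith
  refine intervalIntegral.continuousAt_parametric_primitive_of_dominated
    (F := fun x t => w t * g x t) (fun _ => K * (M + 1)) a b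
    (fun x => (hw.aesm_mul (hgq x)).restrict) ?_ intervalIntegrable_const
    (Eventually.of_forall fun t => ?_) ⟨ha.1, hb'.1⟩ ⟨ha.2, hb'.2⟩ (by simp)
  · filter_upwards [hev] with x hx
    refine (ae_restrict_iff' measurableSet_uIoc).2 (Eventually.of_forall fun t ht => ?_)
    rw [uIoc_of_le hab] at ht
    rw [Real.norm_eq_abs, abs_mul]
    exact mul_le_mul (hb t) (hx t (Ioc_subset_Icc_self ht)).le (abs_nonneg _) hK
  · exact (continuous_const.mul (hg.comp (Continuous.prodMk_left t))).continuousAt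

lemma continuous_primitive (hw : IsCoefficient w) {f : ℝ → ℝ} (hf : Continuous f) :
    Continuous fun x => ∫ t in (0 : ℝ)..x, w t * f t :=
  intervalIntegral.continuous_primitive (hw.intervalIntegrable_mul hf) 0

lemma hasDerivAt_primitive (hw : IsCoefficient w) {f : ℝ → ℝ} (hf : Continuous f) {x : ℝ}
    (hx : ContinuousAt w x) :
    HasDerivAt (fun x => ∫ t in (0 : ℝ)..x, w t * f t) (w x * f x) x :=
  intervalIntegral.integral_hasDerivAt_right (hw.intervalIntegrable_mul hf _ _)
    ((hw.aesm_mul hf).stronglyMeasurableAtFilter) (hx.mul hf.continuousAt)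

/-- Each integration gains a power of |x| and a factor 1/(n+1); iterated, this produces the
factorials behind convergence of the series. -/
lemma abs_primitive_le {K : ℝ} (hb : ∀ x, |w x| ≤ K) {f : ℝ → ℝ}
    {c : ℝ} {n : ℕ} (hf : ∀ x, |f x| ≤ c * |x| ^ n) (x : ℝ) :
    |∫ t in (0 : ℝ)..x, w t * f t| ≤ K * c / (n + 1) * |x| ^ (n + 1) := by
  have hK : 0 ≤ K := (abs_nonneg _).trans (hb 0)
  rw [intervalIntegral.abs_intervalIntegral_eq]
  have h1 : ‖∫ t in Ι 0 x, w t * f t‖ ≤ ∫ t in Ι 0 x, K * c * |t - 0| ^ n := by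
    refine norm_integral_le_of_norm_le ?_ (Eventually.of_forall fun t => ?_)
    · exact (intervalIntegrable_iff.1 (Continuous.intervalIntegrable (by fun_prop) _ _))
    · rw [sub_zero, Real.norm_eq_abs, abs_mul, mul_assoc]
      exact mul_le_mul (hb t) (hf t) (abs_nonneg _) hK
  refine h1.trans (le_of_eq ?_)
  rw [integral_const_mul, integral_pow_abs_sub_uIoc, sub_zero]
  ring

lemma primitive_nonneg (hpos : ∀ x, 0 < w x) {f : ℝ → ℝ} (hf : ∀ x, 0 ≤ x → 0 ≤ f x)
    {x : ℝ} (hx : 0 ≤ x) : 0 ≤ ∫ t in (0 : ℝ)..x, w t * f t :=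
  intervalIntegral.integral_nonneg hx fun t ht => mul_nonneg (hpos t).le (hf t ht.1)

lemma primitive_pos (hw : IsCoefficient w) (hpos : ∀ x, 0 < w x) {f : ℝ → ℝ}
    (hfc : Continuous f) (hf : ∀ x, 0 ≤ x → 0 < f x) {x : ℝ} (hx : 0 < x) :
    0 < ∫ t in (0 : ℝ)..x, w t * f t :=
  intervalIntegral.intervalIntegral_pos_of_pos_on (hw.intervalIntegrable_mul hfc _ _)
    (fun t ht => mul_pos (hpos t) (hf t ht.1.le)) hx

end IsCoefficient

/-! ### Fundamental solutions as power series in the energy. -/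

/-- The coefficients of the expansion of a fundamental solution in powers of `-E`. -/
def iteratedPrimitive (a b : ℝ → ℝ) : ℕ → ℝ → ℝ
  | 0 => fun _ => 1
  | n + 1 => fun x => ∫ t in (0 : ℝ)..x, b t * ∫ s in (0 : ℝ)..t, a s * iteratedPrimitive a b n s

/-- The solution of `(b⁻¹ F')' = -E a F` with `F 0 = 1` and vanishing flux at `0`. -/
def cosSolution (a b : ℝ → ℝ) (E x : ℝ) : ℝ := ∑' n : ℕ, (-E) ^ n * iteratedPrimitive a b n x

/-- The primitive of `a F` for `F` the solution `cosSolution a b E`. -/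
def sinSolution (a b : ℝ → ℝ) (E x : ℝ) : ℝ := ∫ t in (0 : ℝ)..x, a t * cosSolution a b E t

section Series

variable {a b : ℝ → ℝ}

lemma continuous_iteratedPrimitive (ha : IsCoefficient a) (hb : IsCoefficient b) (n : ℕ) :
    Continuous (iteratedPrimitive a b n) := by
  induction n with
  | zero => exact continuous_const
  | succ n ih => exact hb.continuous_primitive (ha.continuous_primitive ih)

lemma abs_iteratedPrimitive_le {K : ℝ}
    (hKa : ∀ x, |a x| ≤ K) (hKb : ∀ x, |b x| ≤ K) (n : ℕ) (x : ℝ) :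
    |iteratedPrimitive a b n x| ≤ K ^ (2 * n) / (2 * n).factorial * |x| ^ (2 * n) := by
  induction n generalizing x with
  | zero => simp [iteratedPrimitive]
  | succ n ih =>
    have h := IsCoefficient.abs_primitive_le hKb (IsCoefficient.abs_primitive_le hKa ih) x
    refine h.trans (le_of_eq ?_)
    have : 2 * (n + 1) = 2 * n + 1 + 1 := by ring
    rw [this, Nat.factorial_succ, Nat.factorial_succ]
    have h0 : ((2 * n).factorial : ℝ) ≠ 0 := by positivity
    push_cast
    field_simp
    ring

lemma exists_summable_bound (ha : IsCoefficient a) (hb : IsCoefficient b) (R : ℝ) :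
    ∃ u : ℕ → ℝ, Summable u ∧ ∀ n E x, |E| ≤ R → |x| ≤ R →
      |(-E) ^ n * iteratedPrimitive a b n x| ≤ u n := by
  obtain ⟨K, hK, hKa⟩ := ha.bounded
  obtain ⟨L, hL, hLb⟩ := hb.bounded
  refine ⟨fun n => (R * ((K + L) * R) ^ 2) ^ n / n.factorial,
    Real.summable_pow_div_factorial _, fun n E x hE hx => ?_⟩
  have hR : 0 ≤ R := (abs_nonneg _).trans hE
  have h := abs_iteratedPrimitive_le (K := K + L) (fun x => (hKa x).trans (by linarith))
    (fun x => (hLb x).trans (by linarith)) n x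
  rw [abs_mul, abs_pow, abs_neg]
  -- Weakening (2n)! to n! suffices: the majorant becomes an exponential series.
  have h2 : (K + L) ^ (2 * n) / (2 * n).factorial * |x| ^ (2 * n) ≤
      (K + L) ^ (2 * n) / n.factorial * R ^ (2 * n) := by
    gcongr
    omega
  calc |E| ^ n * |iteratedPrimitive a b n x|
      ≤ R ^ n * ((K + L) ^ (2 * n) / n.factorial * R ^ (2 * n)) := by
        gcongr
        exact h.trans h2
    _ = (R * ((K + L) * R) ^ 2) ^ n / n.factorial := by
        rw [mul_pow, ← pow_mul, mul_pow]; ring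

lemma summable_cosSolution (ha : IsCoefficient a) (hb : IsCoefficient b) (E x : ℝ) :
    Summable fun n : ℕ => (-E) ^ n * iteratedPrimitive a b n x := by
  obtain ⟨u, hu, hle⟩ := exists_summable_bound ha hb (max |E| |x|)
  exact hu.of_norm_bounded fun n => hle n E x (le_max_left _ _) (le_max_right _ _)

lemma continuous_uncurry_cosSolution (ha : IsCoefficient a) (hb : IsCoefficient b) :
    Continuous (Function.uncurry (cosSolution a b)) := by
  rw [continuous_iff_continuousAt]
  rintro ⟨E₀, x₀⟩
  obtain ⟨u, hu, hle⟩ := exists_summable_bound ha hb (max (|E₀| + 1) (|x₀| + 1))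
  have hs : {p : ℝ × ℝ | |p.1| < |E₀| + 1 ∧ |p.2| < |x₀| + 1} ∈ 𝓝 (E₀, x₀) := by
    exact IsOpen.mem_nhds ((isOpen_lt continuous_fst.abs continuous_const).inter
      (isOpen_lt continuous_snd.abs continuous_const)) ⟨lt_add_one _, lt_add_one _⟩
  refine ContinuousOn.continuousAt (continuousOn_tsum (u := u) (fun n => ?_) hu ?_) hs
  · exact (((continuous_fst.neg.pow n).mul
      ((continuous_iteratedPrimitive ha hb n).comp continuous_snd))).continuousOn
  · rintro n ⟨E, x⟩ ⟨hE, hx⟩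
    exact hle n E x (hE.le.trans (le_max_left _ _)) (hx.le.trans (le_max_right _ _))

lemma continuous_cosSolution (ha : IsCoefficient a) (hb : IsCoefficient b) (E : ℝ) :
    Continuous (cosSolution a b E) :=
  (continuous_uncurry_cosSolution ha hb).comp (Continuous.prodMk_right E)

lemma continuous_uncurry_sinSolution (ha : IsCoefficient a) (hb : IsCoefficient b) :
    Continuous (Function.uncurry (sinSolution a b)) :=
  ha.continuous_parametric_primitive (continuous_uncurry_cosSolution ha hb)

lemma continuous_sinSolution (ha : IsCoefficient a) (hb : IsCoefficient b) (E : ℝ) :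
    Continuous (sinSolution a b E) :=
  (continuous_uncurry_sinSolution ha hb).comp (Continuous.prodMk_right E)

/-- Termwise integration of a series of continuous functions against a coefficient. -/
lemma IsCoefficient.hasSum_primitive {w : ℝ → ℝ} (hw : IsCoefficient w) {f : ℕ → ℝ → ℝ}
    {F : ℝ → ℝ} (hf : ∀ n, Continuous (f n)) {x : ℝ} {u : ℕ → ℝ} (hu : Summable u)
    (hle : ∀ n t, |t| ≤ |x| → |f n t| ≤ u n) (hF : ∀ t, HasSum (fun n => f n t) (F t)) :
    HasSum (fun n => ∫ t in (0 : ℝ)..x, w t * f n t) (∫ t in (0 : ℝ)..x, w t * F t) := by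
  obtain ⟨K, hK, hb⟩ := hw.bounded
  refine intervalIntegral.hasSum_integral_of_dominated_convergence (fun n _ => K * u n)
    (fun n => (hw.aesm_mul (hf n)).restrict) (fun n => Eventually.of_forall fun t ht => ?_)
    (Eventually.of_forall fun _ _ => hu.mul_left K) intervalIntegrable_const
    (Eventually.of_forall fun t _ => (hF t).mul_left _)
  have htx : |t| ≤ |x| := by
    rcases le_total 0 x with h | h
    · rw [uIoc_of_le h] at ht
      rw [abs_of_pos ht.1, abs_of_nonneg h]; exact ht.2
    · rw [uIoc_of_ge h] at ht
      rw [abs_of_nonpos ht.2, abs_of_nonpos h]; linarith [ht.1]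
  rw [Real.norm_eq_abs, abs_mul]
  exact mul_le_mul (hb t) (hle n t htx) (abs_nonneg _) hK

/-- Two termwise integrations shift the series by one index. The resulting integral equation
replaces differentiation of the series and remains valid across discontinuities of the coefficients.
-/
lemma cosSolution_eq (ha : IsCoefficient a) (hb : IsCoefficient b) (E x : ℝ) :
    cosSolution a b E x = 1 - E * ∫ t in (0 : ℝ)..x, b t * sinSolution a b E t := by
  obtain ⟨K, hK, hKa⟩ := ha.bounded
  obtain ⟨u, hu, hle⟩ := exists_summable_bound ha hb (max |E| |x|)
  have hcont : ∀ n, Continuous fun t => (-E) ^ n * iteratedPrimitive a b n t := fun n =>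
    continuous_const.mul (continuous_iteratedPrimitive ha hb n)
  have hsin : ∀ t, HasSum
      (fun n => ∫ s in (0 : ℝ)..t, a s * ((-E) ^ n * iteratedPrimitive a b n s))
      (sinSolution a b E t) := fun t => by
    obtain ⟨v, hv, hlv⟩ := exists_summable_bound ha hb (max |E| |t|)
    exact ha.hasSum_primitive hcont hv
      (fun n s hs => hlv n E s (le_max_left _ _) (hs.trans (le_max_right _ _)))
      (fun s => (summable_cosSolution ha hb E s).hasSum)
  have h := hb.hasSum_primitive (x := x) (fun n => ha.continuous_primitive (hcont n))
    (hu.mul_left (K * |x|)) (fun n t ht => ?_) hsin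
  · have h2 := h.mul_left (-E)
    rw [cosSolution, (summable_cosSolution ha hb E x).tsum_eq_zero_add]
    have h3 : (fun n : ℕ => (-E) ^ (n + 1) * iteratedPrimitive a b (n + 1) x) = fun n : ℕ =>
        -E * ∫ t in (0 : ℝ)..x, b t *
          ∫ s in (0 : ℝ)..t, a s * ((-E) ^ n * iteratedPrimitive a b n s) := by
      funext n
      simp only [iteratedPrimitive, mul_left_comm _ ((-E) ^ n),
        intervalIntegral.integral_const_mul]
      ring
    rw [h3, h2.tsum_eq]
    simp only [iteratedPrimitive]
    ring
  · have h4 := intervalIntegral.norm_integral_le_of_norm_le_const (a := 0) (b := t)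
      (f := fun s => a s * ((-E) ^ n * iteratedPrimitive a b n s)) (C := K * u n) fun s hs => by
        have hst : |s| ≤ |t| := by
          rcases le_total 0 t with h | h
          · rw [uIoc_of_le h] at hs
            rw [abs_of_pos hs.1, abs_of_nonneg h]; exact hs.2
          · rw [uIoc_of_ge h] at hs
            rw [abs_of_nonpos hs.2, abs_of_nonpos h]; linarith [hs.1]
        rw [Real.norm_eq_abs, abs_mul]
        exact mul_le_mul (hKa s) (hle n E s (le_max_left _ _)
          ((hst.trans ht).trans (le_max_right _ _))) (abs_nonneg _) hK
    have hun : 0 ≤ u n := (abs_nonneg _).trans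
      (hle n E x (le_max_left _ _) (le_max_right _ _))
    rw [Real.norm_eq_abs, sub_zero] at h4
    calc _ ≤ K * u n * |t| := h4
      _ ≤ K * u n * |x| := by gcongr
      _ = K * |x| * u n := by ring

lemma hasDerivAt_cosSolution (ha : IsCoefficient a) (hb : IsCoefficient b) (E : ℝ) {x : ℝ}
    (hx : ContinuousAt b x) :
    HasDerivAt (cosSolution a b E) (-(E * (b x * sinSolution a b E x))) x := by
  rw [funext (cosSolution_eq ha hb E)]
  exact ((hb.hasDerivAt_primitive (continuous_sinSolution ha hb E) hx).const_mul E).const_sub 1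

lemma hasDerivAt_sinSolution (ha : IsCoefficient a) (hb : IsCoefficient b) (E : ℝ) {x : ℝ}
    (hx : ContinuousAt a x) :
    HasDerivAt (sinSolution a b E) (a x * cosSolution a b E x) x :=
  ha.hasDerivAt_primitive (continuous_cosSolution ha hb E) hx

lemma cosSolution_apply_zero (ha : IsCoefficient a) (hb : IsCoefficient b) (E : ℝ) :
    cosSolution a b E 0 = 1 := by
  simp [cosSolution_eq ha hb]

lemma sinSolution_apply_zero (E : ℝ) : sinSolution a b E 0 = 0 := by
  simp [sinSolution]

lemma iteratedPrimitive_nonneg (hpa : ∀ x, 0 < a x) (hpb : ∀ x, 0 < b x) (n : ℕ) {x : ℝ}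
    (hx : 0 ≤ x) : 0 ≤ iteratedPrimitive a b n x := by
  induction n generalizing x with
  | zero => exact zero_le_one
  | succ n ih =>
    exact IsCoefficient.primitive_nonneg hpb
      (fun t ht => IsCoefficient.primitive_nonneg hpa (fun s hs => ih hs) ht) hx

lemma one_le_cosSolution (ha : IsCoefficient a) (hb : IsCoefficient b) (hpa : ∀ x, 0 < a x)
    (hpb : ∀ x, 0 < b x) {E x : ℝ} (hE : E ≤ 0) (hx : 0 ≤ x) : 1 ≤ cosSolution a b E x := by
  have h := (summable_cosSolution ha hb E x).le_tsum 0 fun n _ =>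
    mul_nonneg (pow_nonneg (neg_nonneg.2 hE) n) (iteratedPrimitive_nonneg hpa hpb n hx)
  rwa [pow_zero, one_mul] at h

lemma sinSolution_pos (ha : IsCoefficient a) (hb : IsCoefficient b) (hpa : ∀ x, 0 < a x)
    (hpb : ∀ x, 0 < b x) {E x : ℝ} (hE : E ≤ 0) (hx : 0 < x) : 0 < sinSolution a b E x :=
  ha.primitive_pos hpa (continuous_cosSolution ha hb E)
    (fun _ ht => zero_lt_one.trans_le (one_le_cosSolution ha hb hpa hpb hE ht)) hx

end Series

/-! ### Wronskians, parity, and translation by a period. -/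

/-- The standing assumptions on the material coefficients. -/
structure IsMaterial (ε μ : ℝ → ℝ) : Prop where
  coeff_ε : IsCoefficient ε
  coeff_μ : IsCoefficient μ
  ε_pos : ∀ x, 0 < ε x
  μ_pos : ∀ x, 0 < μ x
  ε_add_one : ∀ x, ε (x + 1) = ε x
  μ_add_one : ∀ x, μ (x + 1) = μ x
  ε_neg : ∀ x, ε (-x) = ε x
  μ_neg : ∀ x, μ (-x) = μ x

/-- Real solutions of the eigenvalue equation, together with their flux. -/
structure IsRealSolution (ε μ : ℝ → ℝ) (E : ℝ) (y v : ℝ → ℝ) : Prop where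
  continuous : Continuous y
  continuous_flux : Continuous v
  hasDerivAt : ∀ x, ContinuousAt ε x → ContinuousAt μ x → HasDerivAt y (μ x * v x) x
  hasDerivAt_flux : ∀ x, ContinuousAt ε x → ContinuousAt μ x → HasDerivAt v (-(E * ε x * y x)) x

section Solutions

variable {ε μ : ℝ → ℝ}

lemma IsMaterial.countable (h : IsMaterial ε μ) :
    {x | ¬ (ContinuousAt ε x ∧ ContinuousAt μ x)}.Countable :=
  (h.coeff_ε.countable.union h.coeff_μ.countable).mono fun _ hx => not_and_or.1 hx

lemma IsMaterial.exists_regular (h : IsMaterial ε μ) {a b : ℝ} (hab : a < b) :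
    ∃ x ∈ Ioo a b, ContinuousAt ε x ∧ ContinuousAt μ x := by
  by_contra! hcon
  have : (Ioo a b).Countable := h.countable.mono fun x hx =>
    show ¬ (ContinuousAt ε x ∧ ContinuousAt μ x) from fun hx' => hcon x hx hx'.1 hx'.2
  exact (Cardinal.Real.Ioo_countable_iff.1 this).not_gt hab

lemma cosSolution_isRealSolution (h : IsMaterial ε μ) (E : ℝ) :
    IsRealSolution ε μ E (cosSolution ε μ E) (fun x => -E * sinSolution ε μ E x) where
  continuous := continuous_cosSolution h.coeff_ε h.coeff_μ E
  continuous_flux := continuous_const.mul (continuous_sinSolution h.coeff_ε h.coeff_μ E)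
  hasDerivAt x _ hx := by
    convert hasDerivAt_cosSolution h.coeff_ε h.coeff_μ E hx using 1
    ring
  hasDerivAt_flux x hx _ := by
    exact ((hasDerivAt_sinSolution h.coeff_ε h.coeff_μ E hx).const_mul (-E)).congr_deriv (by ring)

/-- Exchanging ε and μ exchanges, up to constants, solution and flux, so one series construction
yields both fundamental solutions. -/
lemma sinSolution_isRealSolution (h : IsMaterial ε μ) (E : ℝ) :
    IsRealSolution ε μ E (sinSolution μ ε E) (cosSolution μ ε E) where
  continuous := continuous_sinSolution h.coeff_μ h.coeff_ε E
  continuous_flux := continuous_cosSolution h.coeff_μ h.coeff_ε E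
  hasDerivAt x _ hx := hasDerivAt_sinSolution h.coeff_μ h.coeff_ε E hx
  hasDerivAt_flux x hx _ := by
    convert hasDerivAt_cosSolution h.coeff_μ h.coeff_ε E hx using 1
    ring

/-- The main analytic tool. Equal energies give a conserved Wronskian, hence uniqueness; distinct
energies give the derivative of the half-period data with respect to E. -/
lemma IsRealSolution.wronskian_eq (h : IsMaterial ε μ) {E E' : ℝ} {y v z w : ℝ → ℝ}
    (hy : IsRealSolution ε μ E y v) (hz : IsRealSolution ε μ E' z w) (x : ℝ) :
    y x * w x - v x * z x =
      y 0 * w 0 - v 0 * z 0 + (E - E') * ∫ t in (0 : ℝ)..x, ε t * (y t * z t) := by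
  have := integral_eq_of_hasDerivAt_off_countable (fun x => y x * w x - v x * z x)
    (fun x => (E - E') * (ε x * (y x * z x))) (a := 0) (b := x) h.countable
    (((hy.continuous.mul hz.continuous_flux).sub
      (hy.continuous_flux.mul hz.continuous)).continuousOn)
    (fun t ht => by
      obtain ⟨h1, h2⟩ := not_not.1 ht.2
      exact (((hy.hasDerivAt t h1 h2).mul (hz.hasDerivAt_flux t h1 h2)).sub
        ((hy.hasDerivAt_flux t h1 h2).mul (hz.hasDerivAt t h1 h2))).congr_deriv (by ring))
    ((h.coeff_ε.intervalIntegrable_mul (hy.continuous.mul hz.continuous) _ _).const_mul _)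
  rw [intervalIntegral.integral_const_mul] at this
  linarith

lemma cos_mul_cos_add (h : IsMaterial ε μ) (E x : ℝ) :
    cosSolution ε μ E x * cosSolution μ ε E x
      + E * sinSolution ε μ E x * sinSolution μ ε E x = 1 := by
  have := (cosSolution_isRealSolution h E).wronskian_eq h (sinSolution_isRealSolution h E) x
  simp only [cosSolution_apply_zero h.coeff_ε h.coeff_μ, cosSolution_apply_zero h.coeff_μ h.coeff_ε,
    sinSolution_apply_zero, sub_self] at this
  linarith

/-- Cramer's rule applied to the two conserved Wronskians with the fundamental solutions, whose own
Wronskian is 1. -/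
lemma IsRealSolution.eq (h : IsMaterial ε μ) {E : ℝ} {y v : ℝ → ℝ}
    (hy : IsRealSolution ε μ E y v) (x : ℝ) :
    y x = y 0 * cosSolution ε μ E x + v 0 * sinSolution μ ε E x := by
  have h1 := hy.wronskian_eq h (cosSolution_isRealSolution h E) x
  have h2 := hy.wronskian_eq h (sinSolution_isRealSolution h E) x
  simp only [cosSolution_apply_zero h.coeff_ε h.coeff_μ, cosSolution_apply_zero h.coeff_μ h.coeff_ε,
    sinSolution_apply_zero, sub_self] at h1 h2
  linear_combination (-y x) * cos_mul_cos_add h E x + cosSolution ε μ E x * h2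
    - sinSolution μ ε E x * h1

lemma IsRealSolution.flux_eq (h : IsMaterial ε μ) {E : ℝ} {y v : ℝ → ℝ}
    (hy : IsRealSolution ε μ E y v) (x : ℝ) :
    v x = y 0 * (-E * sinSolution ε μ E x) + v 0 * cosSolution μ ε E x := by
  have h1 := hy.wronskian_eq h (cosSolution_isRealSolution h E) x
  have h2 := hy.wronskian_eq h (sinSolution_isRealSolution h E) x
  simp only [cosSolution_apply_zero h.coeff_ε h.coeff_μ, cosSolution_apply_zero h.coeff_μ h.coeff_ε,
    sinSolution_apply_zero, sub_self] at h1 h2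
  linear_combination (-v x) * cos_mul_cos_add h E x + (-E * sinSolution ε μ E x) * h2
    - cosSolution μ ε E x * h1

lemma IsRealSolution.comp_neg (h : IsMaterial ε μ) {E : ℝ} {y v : ℝ → ℝ}
    (hy : IsRealSolution ε μ E y v) :
    IsRealSolution ε μ E (fun x => y (-x)) (fun x => -v (-x)) := by
  have hcont : ∀ {w : ℝ → ℝ}, (∀ x, w (-x) = w x) → ∀ {x}, ContinuousAt w x →
      ContinuousAt w (-x) := fun {w} hw {x} hx => by
    have : ContinuousAt (w ∘ Neg.neg) (-x) :=
      ContinuousAt.comp (by rwa [neg_neg]) continuous_neg.continuousAt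
    rwa [show w ∘ Neg.neg = w from funext hw] at this
  refine ⟨hy.continuous.comp continuous_neg, (hy.continuous_flux.comp continuous_neg).neg,
    fun x h1 h2 => ?_, fun x h1 h2 => ?_⟩
  · exact ((hy.hasDerivAt (-x) (hcont h.ε_neg h1) (hcont h.μ_neg h2)).comp x
      (hasDerivAt_neg x)).congr_deriv (by rw [h.μ_neg]; ring)
  · exact ((hy.hasDerivAt_flux (-x) (hcont h.ε_neg h1) (hcont h.μ_neg h2)).comp x
      (hasDerivAt_neg x)).neg.congr_deriv (by rw [h.ε_neg]; ring)

lemma IsRealSolution.comp_add_one (h : IsMaterial ε μ) {E : ℝ} {y v : ℝ → ℝ}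
    (hy : IsRealSolution ε μ E y v) :
    IsRealSolution ε μ E (fun x => y (x + 1)) (fun x => v (x + 1)) := by
  have hcont : ∀ {w : ℝ → ℝ}, (∀ x, w (x + 1) = w x) → ∀ {x}, ContinuousAt w x →
      ContinuousAt w (x + 1) := fun {w} hw {x} hx => by
    have : ContinuousAt (w ∘ fun t => t - 1) (x + 1) :=
      ContinuousAt.comp (by simpa using hx) (continuous_sub_right 1).continuousAt
    rwa [show (w ∘ fun t => t - 1) = w from funext fun t => by
      simpa using (hw (t - 1)).symm] at this
  refine ⟨hy.continuous.comp (continuous_add_const 1),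
    hy.continuous_flux.comp (continuous_add_const 1), fun x h1 h2 => ?_, fun x h1 h2 => ?_⟩
  · exact ((hy.hasDerivAt (x + 1) (hcont h.ε_add_one h1) (hcont h.μ_add_one h2)).comp_add_const
      x 1).congr_deriv (by rw [h.μ_add_one])
  · exact ((hy.hasDerivAt_flux (x + 1) (hcont h.ε_add_one h1)
      (hcont h.μ_add_one h2)).comp_add_const x 1).congr_deriv (by rw [h.ε_add_one])

lemma cosSolution_neg (h : IsMaterial ε μ) (E x : ℝ) :
    cosSolution ε μ E (-x) = cosSolution ε μ E x := by
  have := ((cosSolution_isRealSolution h E).comp_neg h).eq h x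
  simpa [cosSolution_apply_zero h.coeff_ε h.coeff_μ, sinSolution_apply_zero] using this

lemma sinSolution_neg (h : IsMaterial ε μ) (E x : ℝ) :
    sinSolution μ ε E (-x) = -sinSolution μ ε E x := by
  have := ((sinSolution_isRealSolution h E).comp_neg h).eq h x
  simpa [cosSolution_apply_zero h.coeff_μ h.coeff_ε, sinSolution_apply_zero] using this

lemma IsMaterial.symm (h : IsMaterial ε μ) : IsMaterial μ ε :=
  ⟨h.coeff_μ, h.coeff_ε, h.μ_pos, h.ε_pos, h.μ_add_one, h.ε_add_one, h.μ_neg, h.ε_neg⟩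

/-- Half the trace of the monodromy matrix, in terms of the solutions at the half period. -/
def discriminant (ε μ : ℝ → ℝ) (E : ℝ) : ℝ :=
  cosSolution ε μ E (1 / 2) * cosSolution μ ε E (1 / 2)
    - E * sinSolution ε μ E (1 / 2) * sinSolution μ ε E (1 / 2)

/-- The translate is a combination of the fundamental solutions with unknown coefficients, its data
at 0. At x = -1/2 the translate has the known value and flux at 1/2, while parity expresses the
fundamental solutions at -1/2 through those at 1/2. A linear system of determinant 1 results. -/
lemma cosSolution_add_one (h : IsMaterial ε μ) (E x : ℝ) :
    cosSolution ε μ E (x + 1) = discriminant ε μ E * cosSolution ε μ E x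
      + 2 * cosSolution ε μ E (1 / 2) * (-E * sinSolution ε μ E (1 / 2)) * sinSolution μ ε E x := by
  have hs := (cosSolution_isRealSolution h E).comp_add_one h
  have h1 := hs.eq h (-(1 / 2))
  have h2 := hs.flux_eq h (-(1 / 2))
  have hw := cos_mul_cos_add h E (1 / 2)
  rw [hs.eq h x]
  simp only [cosSolution_neg h, cosSolution_neg h.symm, sinSolution_neg h, sinSolution_neg h.symm,
    zero_add, show -(1 / 2 : ℝ) + 1 = 1 / 2 by norm_num] at h1 h2 ⊢
  have e1 : cosSolution ε μ E 1 = discriminant ε μ E := by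
    rw [discriminant]
    linear_combination (-cosSolution ε μ E 1) * hw - cosSolution μ ε E (1 / 2) * h1
      - sinSolution μ ε E (1 / 2) * h2
  have e2 : -E * sinSolution ε μ E 1 =
      2 * cosSolution ε μ E (1 / 2) * (-E * sinSolution ε μ E (1 / 2)) := by
    linear_combination (E * sinSolution ε μ E 1) * hw
      + (E * sinSolution ε μ E (1 / 2)) * h1 - cosSolution ε μ E (1 / 2) * h2
  rw [e1, e2]

lemma sinSolution_add_one (h : IsMaterial ε μ) (E x : ℝ) :
    sinSolution μ ε E (x + 1) =
      2 * sinSolution μ ε E (1 / 2) * cosSolution μ ε E (1 / 2) * cosSolution ε μ E x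
      + discriminant ε μ E * sinSolution μ ε E x := by
  have hs := (sinSolution_isRealSolution h E).comp_add_one h
  have h1 := hs.eq h (-(1 / 2))
  have h2 := hs.flux_eq h (-(1 / 2))
  have hw := cos_mul_cos_add h E (1 / 2)
  rw [hs.eq h x]
  simp only [cosSolution_neg h, cosSolution_neg h.symm, sinSolution_neg h, sinSolution_neg h.symm,
    zero_add, show -(1 / 2 : ℝ) + 1 = 1 / 2 by norm_num] at h1 h2 ⊢
  have e1 : sinSolution μ ε E 1 =
      2 * sinSolution μ ε E (1 / 2) * cosSolution μ ε E (1 / 2) := by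
    linear_combination (-sinSolution μ ε E 1) * hw - cosSolution μ ε E (1 / 2) * h1
      - sinSolution μ ε E (1 / 2) * h2
  have e2 : cosSolution μ ε E 1 = discriminant ε μ E := by
    rw [discriminant]
    linear_combination (-cosSolution μ ε E 1) * hw
      + (E * sinSolution ε μ E (1 / 2)) * h1 - cosSolution ε μ E (1 / 2) * h2
  rw [e1, e2]

/-- If y vanished on the interval, then at a point of continuity of the coefficients y' = 0 would
make the flux vanish too, and the conserved Wronskians would carry zero data back to 0. -/
lemma IsRealSolution.exists_ne_zero (h : IsMaterial ε μ) {E : ℝ} {y v : ℝ → ℝ}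
    (hy : IsRealSolution ε μ E y v) (hne : y 0 ≠ 0 ∨ v 0 ≠ 0) {b : ℝ} (hb : 0 < b) :
    ∃ x ∈ Ioo 0 b, y x ≠ 0 := by
  by_contra! hcon
  obtain ⟨x, hx, h1, h2⟩ := h.exists_regular hb
  have hd : HasDerivAt y 0 x := (hasDerivAt_const x (0 : ℝ)).congr_of_eventuallyEq
    (eventually_of_mem (Ioo_mem_nhds hx.1 hx.2) fun t ht => hcon t ht)
  have hv : v x = 0 :=
    (mul_eq_zero.1 ((hy.hasDerivAt x h1 h2).unique hd)).resolve_left (h.μ_pos x).ne'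
  have e1 := hy.wronskian_eq h (cosSolution_isRealSolution h E) x
  have e2 := hy.wronskian_eq h (sinSolution_isRealSolution h E) x
  simp [cosSolution_apply_zero h.coeff_ε h.coeff_μ, cosSolution_apply_zero h.coeff_μ h.coeff_ε,
    sinSolution_apply_zero, hcon x hx, hv] at e1 e2
  rcases hne with h0 | h0
  exacts [h0 e2.symm, h0 e1]

lemma IsRealSolution.integral_sq_pos (h : IsMaterial ε μ) {E : ℝ} {y v : ℝ → ℝ}
    (hy : IsRealSolution ε μ E y v) (hne : y 0 ≠ 0 ∨ v 0 ≠ 0) {b : ℝ} (hb : 0 < b) :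
    0 < ∫ t in (0 : ℝ)..b, ε t * (y t * y t) := by
  rw [intervalIntegral.integral_pos_iff_support_of_nonneg_ae
    (Eventually.of_forall fun t => mul_nonneg (h.ε_pos t).le (mul_self_nonneg _))
    (h.coeff_ε.intervalIntegrable_mul (hy.continuous.mul hy.continuous) _ _)]
  refine ⟨hb, ?_⟩
  obtain ⟨x, hx, hyx⟩ := hy.exists_ne_zero h hne hb
  have hopen : IsOpen (Ioo 0 b ∩ {t | y t ≠ 0}) :=
    isOpen_Ioo.inter (isOpen_ne_fun hy.continuous continuous_const)
  refine (hopen.measure_pos volume ⟨x, hx, hyx⟩).trans_le (measure_mono fun t ht => ?_)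
  exact ⟨mul_ne_zero (h.ε_pos t).ne' (mul_ne_zero ht.2 ht.2), Ioo_subset_Ioc_self ht.1⟩

end Solutions

/-! ### Bloch modes as eigenvectors of the monodromy matrix. -/

section Bloch

variable {ε μ : ℝ → ℝ}

/-- The pairs `(α, β)` with `(a - z) α + b β = 0` and `c α + (a - z) β = 0`. -/
def multiplierSpace (a b c : ℝ) (z : ℂ) : Submodule ℂ (ℂ × ℂ) where
  carrier := {p | (a - z) * p.1 + b * p.2 = 0 ∧ c * p.1 + (a - z) * p.2 = 0}
  zero_mem' := by simp
  add_mem' := by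
    rintro p q ⟨h1, h2⟩ ⟨h3, h4⟩
    exact ⟨by simp only [Prod.fst_add, Prod.snd_add]; linear_combination h1 + h3,
      by simp only [Prod.fst_add, Prod.snd_add]; linear_combination h2 + h4⟩
  smul_mem' := by
    rintro t p ⟨h1, h2⟩
    exact ⟨by simp only [Prod.smul_fst, Prod.smul_snd, smul_eq_mul]; linear_combination t * h1,
      by simp only [Prod.smul_fst, Prod.smul_snd, smul_eq_mul]; linear_combination t * h2⟩

lemma mem_multiplierSpace {a b c : ℝ} {z : ℂ} {p : ℂ × ℂ} : p ∈ multiplierSpace a b c z ↔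
    (a - z) * p.1 + b * p.2 = 0 ∧ c * p.1 + (a - z) * p.2 = 0 := Iff.rfl

lemma exp_I_mul_eq (k : ℝ) :
    Complex.exp (Complex.I * (k : ℂ)) = (Real.cos k : ℂ) + (Real.sin k : ℂ) * Complex.I := by
  rw [mul_comm, Complex.exp_mul_I, Complex.ofReal_cos, Complex.ofReal_sin]

lemma exp_I_mul_sq (k : ℝ) : Complex.exp (Complex.I * (k : ℂ)) ^ 2 + 1 =
    2 * Real.cos k * Complex.exp (Complex.I * (k : ℂ)) := by
  have h : (Real.sin k : ℂ) ^ 2 + (Real.cos k : ℂ) ^ 2 = 1 := by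
    exact_mod_cast Real.sin_sq_add_cos_sq k
  rw [exp_I_mul_eq]
  linear_combination (-1) * h + (Real.sin k : ℂ) ^ 2 * Complex.I_sq

/-- With z = e^{ik} one has z² + 1 = 2z cos k, so the determinant (a - z)² - bc equals 2z(cos k -
a). The adjugate of the matrix eliminates the unknowns. -/
lemma multiplierSpace_eq_bot {a b c k : ℝ} (hdet : a ^ 2 - b * c = 1) (ha : a ≠ Real.cos k) :
    multiplierSpace a b c (Complex.exp (Complex.I * (k : ℂ))) = ⊥ := by
  have hz := exp_I_mul_sq k
  have hz0 := Complex.exp_ne_zero (Complex.I * (k : ℂ))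
  set z := Complex.exp (Complex.I * (k : ℂ))
  have hdet' : (a : ℂ) ^ 2 - b * c = 1 := by exact_mod_cast hdet
  have hne : 2 * z * ((Real.cos k : ℂ) - a) ≠ 0 :=
    mul_ne_zero (mul_ne_zero two_ne_zero hz0) (sub_ne_zero.2 (by exact_mod_cast ha.symm))
  rw [Submodule.eq_bot_iff]
  rintro ⟨α, β⟩ ⟨h1, h2⟩
  dsimp only at h1 h2
  have e1 : 2 * z * ((Real.cos k : ℂ) - a) * α = 0 := by
    linear_combination (a - z) * h1 - b * h2 - α * hdet' - α * hz
  have e2 : 2 * z * ((Real.cos k : ℂ) - a) * β = 0 := by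
    linear_combination (a - z) * h2 - c * h1 - β * hdet' - β * hz
  rw [(mul_eq_zero.1 e1).resolve_left hne, (mul_eq_zero.1 e2).resolve_left hne]
  rfl

lemma exp_eq_of_sin_eq_zero {k : ℝ} (hk : Real.sin k = 0) :
    Complex.exp (Complex.I * (k : ℂ)) = Real.cos k := by
  rw [exp_I_mul_eq, hk]; simp

lemma finrank_multiplierSpace_eq_two {a k : ℝ} (hdet : a ^ 2 = 1) (ha : a = Real.cos k) :
    Module.finrank ℂ (multiplierSpace a 0 0 (Complex.exp (Complex.I * (k : ℂ)))) = 2 := by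
  have hs : Real.sin k = 0 := by
    have := Real.sin_sq_add_cos_sq k
    rw [← ha, hdet] at this
    exact pow_eq_zero_iff two_ne_zero |>.1 (by linarith)
  have : multiplierSpace a 0 0 (Complex.exp (Complex.I * (k : ℂ))) = ⊤ := by
    rw [exp_eq_of_sin_eq_zero hs, ← ha, eq_top_iff]
    rintro p -
    simp [mem_multiplierSpace]
  rw [this, finrank_top, Module.finrank_prod, Module.finrank_self]

lemma finrank_multiplierSpace_eq_one {a b c k : ℝ} (hdet : a ^ 2 - b * c = 1)
    (ha : a = Real.cos k) (hbc : b ≠ 0 ∨ c ≠ 0) :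
    Module.finrank ℂ (multiplierSpace a b c (Complex.exp (Complex.I * (k : ℂ)))) = 1 := by
  have hz := exp_I_mul_sq k
  set z := Complex.exp (Complex.I * (k : ℂ))
  rw [← ha] at hz
  have hdet' : (a : ℂ) ^ 2 - b * c = 1 := by exact_mod_cast hdet
  rcases hbc with hb | hc
  · have hb' : (b : ℂ) ≠ 0 := by exact_mod_cast hb
    -- The generator solves the first equation; the second then holds because the determinant
    -- vanishes.
    have : multiplierSpace a b c z = ℂ ∙ ((b : ℂ), z - a) := by
      refine le_antisymm ?_ ((Submodule.span_singleton_le_iff_mem _ _).2 ⟨?_, ?_⟩)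
      · rintro ⟨α, β⟩ ⟨h1, -⟩
        dsimp only at h1
        refine Submodule.mem_span_singleton.2 ⟨α / b, Prod.ext ?_ ?_⟩
        · simp [hb']
        · simp only [Prod.smul_snd, smul_eq_mul]
          field_simp
          linear_combination -h1
      · dsimp only; ring
      · dsimp only; linear_combination -hdet' - hz
    rw [this, finrank_span_singleton]
    simp [Prod.ext_iff, hb]
  · have hc' : (c : ℂ) ≠ 0 := by exact_mod_cast hc
    have : multiplierSpace a b c z = ℂ ∙ (z - a, (c : ℂ)) := by
      refine le_antisymm ?_ ((Submodule.span_singleton_le_iff_mem _ _).2 ⟨?_, ?_⟩)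
      · rintro ⟨α, β⟩ ⟨-, h2⟩
        dsimp only at h2
        refine Submodule.mem_span_singleton.2 ⟨β / c, Prod.ext ?_ ?_⟩
        · simp only [Prod.smul_fst, smul_eq_mul]
          field_simp
          linear_combination -h2
        · simp [hc']
      · dsimp only; linear_combination -hdet' - hz
      · dsimp only; ring
    rw [this, finrank_span_singleton]
    simp [Prod.ext_iff, hc]

/-- The combinations of the two fundamental solutions. -/
def superposition (ε μ : ℝ → ℝ) (E : ℝ) : ℂ × ℂ →ₗ[ℂ] (ℝ → ℂ) where
  toFun p x := p.1 * cosSolution ε μ E x + p.2 * sinSolution μ ε E x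
  map_add' p q := by
    funext x; simp only [Prod.fst_add, Prod.snd_add, Pi.add_apply]; ring
  map_smul' t p := by
    funext x
    simp only [Prod.smul_fst, Prod.smul_snd, smul_eq_mul, Pi.smul_apply, RingHom.id_apply]; ring

lemma superposition_apply (E : ℝ) (p : ℂ × ℂ) (x : ℝ) : superposition ε μ E p x =
    p.1 * cosSolution ε μ E x + p.2 * sinSolution μ ε E x := rfl

lemma exists_sinSolution_ne_zero (h : IsMaterial ε μ) (E : ℝ) : ∃ x, sinSolution μ ε E x ≠ 0 := by
  obtain ⟨x, -, hx⟩ := (sinSolution_isRealSolution h E).exists_ne_zero h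
    (Or.inr (by rw [cosSolution_apply_zero h.coeff_μ h.coeff_ε]; exact one_ne_zero)) zero_lt_one
  exact ⟨x, hx⟩

lemma superposition_injective (h : IsMaterial ε μ) (E : ℝ) :
    Function.Injective (superposition ε μ E) := by
  rw [injective_iff_map_eq_zero]
  rintro ⟨α, β⟩ hp
  obtain ⟨x, hx⟩ := exists_sinSolution_ne_zero h E
  have h0 := congrFun hp 0
  have h1 := congrFun hp x
  simp only [superposition_apply, cosSolution_apply_zero h.coeff_ε h.coeff_μ,
    sinSolution_apply_zero, Pi.zero_apply, Complex.ofReal_one, Complex.ofReal_zero, mul_one,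
    mul_zero, add_zero] at h0 h1
  rw [h0, zero_mul, zero_add] at h1
  rw [h0, (mul_eq_zero.1 h1).resolve_right (by exact_mod_cast hx)]
  rfl

lemma SolvesEigenEquation.exists_eq_superposition (h : IsMaterial ε μ) {E : ℝ} {ψ : ℝ → ℂ}
    (hψ : SolvesEigenEquation ε μ E ψ) : ∃ p, ψ = superposition ε μ E p := by
  obtain ⟨hc, v, hv, hd⟩ := hψ
  have hre : IsRealSolution ε μ E (fun x => (ψ x).re) (fun x => (v x).re) :=
    ⟨Complex.continuous_re.comp hc, Complex.continuous_re.comp hv,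
      fun x h1 h2 => (Complex.reCLM.hasFDerivAt.comp_hasDerivAt x (hd x h1 h2).1).congr_deriv
        (by simp),
      fun x h1 h2 => (Complex.reCLM.hasFDerivAt.comp_hasDerivAt x (hd x h1 h2).2).congr_deriv
        (by simp)⟩
  have him : IsRealSolution ε μ E (fun x => (ψ x).im) (fun x => (v x).im) :=
    ⟨Complex.continuous_im.comp hc, Complex.continuous_im.comp hv,
      fun x h1 h2 => (Complex.imCLM.hasFDerivAt.comp_hasDerivAt x (hd x h1 h2).1).congr_deriv
        (by simp),
      fun x h1 h2 => (Complex.imCLM.hasFDerivAt.comp_hasDerivAt x (hd x h1 h2).2).congr_deriv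
        (by simp)⟩
  refine ⟨(ψ 0, v 0), funext fun x => Complex.ext ?_ ?_⟩
  · rw [hre.eq h x, superposition_apply]; simp
  · rw [him.eq h x, superposition_apply]; simp

lemma solvesEigenEquation_superposition (h : IsMaterial ε μ) (E : ℝ) (p : ℂ × ℂ) :
    SolvesEigenEquation ε μ E (superposition ε μ E p) := by
  have h1 := cosSolution_isRealSolution h E
  have h2 := sinSolution_isRealSolution h E
  refine ⟨(continuous_const.mul (Complex.continuous_ofReal.comp h1.continuous)).add
      (continuous_const.mul (Complex.continuous_ofReal.comp h2.continuous)),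
    fun x => p.1 * (-E * sinSolution ε μ E x : ℝ) + p.2 * (cosSolution μ ε E x : ℝ),
    (continuous_const.mul (Complex.continuous_ofReal.comp h1.continuous_flux)).add
      (continuous_const.mul (Complex.continuous_ofReal.comp h2.continuous_flux)),
    fun x he hm => ⟨?_, ?_⟩⟩
  · exact (((h1.hasDerivAt x he hm).ofReal_comp.const_mul p.1).add
      ((h2.hasDerivAt x he hm).ofReal_comp.const_mul p.2)).congr_deriv (by push_cast; ring)
  · exact (((h1.hasDerivAt_flux x he hm).ofReal_comp.const_mul p.1).add
      ((h2.hasDerivAt_flux x he hm).ofReal_comp.const_mul p.2)).congr_deriv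
      (by rw [superposition_apply]; push_cast; ring)

/-- The upper right entry of the monodromy matrix. -/
def upperEntry (ε μ : ℝ → ℝ) (E : ℝ) : ℝ :=
  2 * sinSolution μ ε E (1 / 2) * cosSolution μ ε E (1 / 2)

/-- The lower left entry of the monodromy matrix. -/
def lowerEntry (ε μ : ℝ → ℝ) (E : ℝ) : ℝ :=
  2 * cosSolution ε μ E (1 / 2) * (-E * sinSolution ε μ E (1 / 2))

lemma discriminant_sq_sub (h : IsMaterial ε μ) (E : ℝ) :
    discriminant ε μ E ^ 2 - upperEntry ε μ E * lowerEntry ε μ E = 1 := by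
  have hw := cos_mul_cos_add h E (1 / 2)
  rw [discriminant, upperEntry, lowerEntry]
  linear_combination (cosSolution ε μ E (1 / 2) * cosSolution μ ε E (1 / 2)
      + E * sinSolution ε μ E (1 / 2) * sinSolution μ ε E (1 / 2) + 1) * hw

/-- The defect ψ(x+1) - e^{ik}ψ(x) is itself a combination of the fundamental solutions. By their
independence it vanishes exactly when both coefficients do. -/
lemma blochSpace_eq_map (h : IsMaterial ε μ) (k E : ℝ) :
    blochSpace ε μ k E = (multiplierSpace (discriminant ε μ E) (upperEntry ε μ E)
      (lowerEntry ε μ E) (Complex.exp (Complex.I * (k : ℂ)))).map (superposition ε μ E) := by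
  have key : ∀ (p : ℂ × ℂ) (x : ℝ), superposition ε μ E p (x + 1)
      - Complex.exp (Complex.I * (k : ℂ)) * superposition ε μ E p x =
      ((discriminant ε μ E - Complex.exp (Complex.I * (k : ℂ))) * p.1 + upperEntry ε μ E * p.2)
        * cosSolution ε μ E x
      + (lowerEntry ε μ E * p.1 + (discriminant ε μ E - Complex.exp (Complex.I * (k : ℂ))) * p.2)
        * sinSolution μ ε E x := by
    intro p x
    rw [superposition_apply, superposition_apply, cosSolution_add_one h, sinSolution_add_one h,
      upperEntry, lowerEntry]
    push_cast
    ring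
  ext ψ
  rw [Submodule.mem_map]
  constructor
  · rintro ⟨hψ, hper⟩
    obtain ⟨p, rfl⟩ := hψ.exists_eq_superposition h
    refine ⟨p, ?_, rfl⟩
    obtain ⟨x, hx⟩ := exists_sinSolution_ne_zero h E
    have h0 := key p 0
    have h1 := key p x
    rw [hper, sub_self] at h0 h1
    simp only [cosSolution_apply_zero h.coeff_ε h.coeff_μ, sinSolution_apply_zero,
      Complex.ofReal_one, Complex.ofReal_zero, mul_one, mul_zero, add_zero] at h0
    rw [← h0, zero_mul, zero_add] at h1
    exact ⟨h0.symm, (mul_eq_zero.1 h1.symm).resolve_right (by exact_mod_cast hx)⟩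
  · rintro ⟨p, hp, rfl⟩
    refine ⟨solvesEigenEquation_superposition h E p, fun x => ?_⟩
    rw [← sub_eq_zero, key, hp.1, hp.2, zero_mul, zero_mul, zero_add]

lemma finrank_blochSpace (h : IsMaterial ε μ) (k E : ℝ) :
    Module.finrank ℂ (blochSpace ε μ k E) = Module.finrank ℂ (multiplierSpace
      (discriminant ε μ E) (upperEntry ε μ E) (lowerEntry ε μ E)
      (Complex.exp (Complex.I * (k : ℂ)))) := by
  rw [blochSpace_eq_map h]
  exact (Submodule.equivMapOfInjective _ (superposition_injective h E) _).symm.finrank_eq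

lemma IsBlochMode.discriminant_eq (h : IsMaterial ε μ) {k E : ℝ} {φ : ℝ → ℂ}
    (hφ : IsBlochMode ε μ k E φ) : discriminant ε μ E = Real.cos k := by
  by_contra hne
  have := hφ.1
  rw [blochSpace_eq_map h, multiplierSpace_eq_bot (discriminant_sq_sub h E) hne,
    Submodule.map_bot, Submodule.mem_bot] at this
  exact hφ.2 this

/-- Here the multiplier is real and equals the diagonal entry, so the first equation reduces to b β
= 0 and the odd component is absent. -/
lemma IsBlochMode.even (h : IsMaterial ε μ) {k E : ℝ} {φ : ℝ → ℂ} (hφ : IsBlochMode ε μ k E φ)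
    (hk : Real.sin k = 0) (hb : upperEntry ε μ E ≠ 0) : Function.Even φ := by
  have hd := hφ.discriminant_eq h
  have hmem := hφ.1
  rw [blochSpace_eq_map h, exp_eq_of_sin_eq_zero hk, ← hd] at hmem
  obtain ⟨p, hp, rfl⟩ := hmem
  have h2 : p.2 = 0 := by
    have := hp.1
    rw [sub_self, zero_mul, zero_add] at this
    exact (mul_eq_zero.1 this).resolve_left (by exact_mod_cast hb)
  intro x
  rw [superposition_apply, superposition_apply, h2, cosSolution_neg h, zero_mul, zero_mul]

lemma IsBlochMode.odd (h : IsMaterial ε μ) {k E : ℝ} {φ : ℝ → ℂ} (hφ : IsBlochMode ε μ k E φ)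
    (hk : Real.sin k = 0) (hc : lowerEntry ε μ E ≠ 0) : Function.Odd φ := by
  have hd := hφ.discriminant_eq h
  have hmem := hφ.1
  rw [blochSpace_eq_map h, exp_eq_of_sin_eq_zero hk, ← hd] at hmem
  obtain ⟨p, hp, rfl⟩ := hmem
  have h1 : p.1 = 0 := by
    have := hp.2
    rw [sub_self, zero_mul, add_zero] at this
    exact (mul_eq_zero.1 this).resolve_left (by exact_mod_cast hc)
  intro x
  rw [superposition_apply, superposition_apply, h1, sinSolution_neg h]
  push_cast
  ring

end Bloch

/-! ### Polar angles of the half-period data. -/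

section Angles

/-- A curve in the punctured plane that turns counterclockwise has a continuous strictly
increasing polar angle. -/
lemma exists_strictMono_angle {X Y X' Y' : ℝ → ℝ} (hX : ∀ t, HasDerivAt X (X' t) t)
    (hY : ∀ t, HasDerivAt Y (Y' t) t) (hX' : Continuous X') (hY' : Continuous Y')
    (hturn : ∀ t, 0 < X t * Y' t - Y t * X' t) :
    ∃ θ : ℝ → ℝ, Continuous θ ∧ StrictMono θ ∧ θ 0 = Complex.arg (X 0 + Y 0 * Complex.I) ∧
      ∀ t, ∃ ρ : ℝ, 0 < ρ ∧ X t = ρ * Real.cos (θ t) ∧ Y t = ρ * Real.sin (θ t) := by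
  set z : ℝ → ℂ := fun t => X t + Y t * Complex.I with hz
  have hre : ∀ t, (z t).re = X t := fun t => by simp [hz]
  have him : ∀ t, (z t).im = Y t := fun t => by simp [hz]
  have hz0 : ∀ t, z t ≠ 0 := fun t h0 => by
    have h1 : X t = 0 := by rw [← hre, h0, Complex.zero_re]
    have h2 : Y t = 0 := by rw [← him, h0, Complex.zero_im]
    have := hturn t
    rw [h1, h2] at this
    simp at this
  set z' : ℝ → ℂ := fun t => X' t + Y' t * Complex.I with hz'
  have hzd : ∀ t, HasDerivAt z (z' t) t := fun t =>
    (hX t).ofReal_comp.add ((hY t).ofReal_comp.mul_const _)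
  have hzc : Continuous z := continuous_iff_continuousAt.2 fun t => (hzd t).continuousAt
  have hl : Continuous fun t => z' t / z t :=
    ((Complex.continuous_ofReal.comp hX').add
      ((Complex.continuous_ofReal.comp hY').mul continuous_const)).div hzc hz0
  set Φ : ℝ → ℂ := fun t => ∫ s in (0 : ℝ)..t, z' s / z s with hΦ
  have hΦd : ∀ t, HasDerivAt Φ (z' t / z t) t := fun t => hl.integral_hasStrictDerivAt 0 t |>.hasDerivAt
  -- Φ is the primitive of the logarithmic derivative of z, so it supplies a global logarithm; its
  -- imaginary part is the change of angle.
  have hconst : ∀ t, z t * Complex.exp (-Φ t) = z 0 := by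
    have hd : ∀ t, HasDerivAt (fun t => z t * Complex.exp (-Φ t)) 0 t := fun t =>
      ((hzd t).mul (hΦd t).neg.cexp).congr_deriv (by field_simp [hz0 t]; ring)
    intro t
    have := is_const_of_deriv_eq_zero (fun t => (hd t).differentiableAt) (fun t => (hd t).deriv) t 0
    simpa [hΦ] using this
  have hexp : ∀ t, z t = z 0 * Complex.exp (Φ t) := fun t => by
    rw [← hconst t, mul_assoc, ← Complex.exp_add, neg_add_cancel, Complex.exp_zero, mul_one]
  have hθd : ∀ t, HasDerivAt (fun t => Complex.arg (z 0) + (Φ t).im) (z' t / z t).im t := fun t =>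
    (Complex.imCLM.hasFDerivAt.comp_hasDerivAt t (hΦd t)).const_add _
  refine ⟨fun t => Complex.arg (z 0) + (Φ t).im,
    continuous_iff_continuousAt.2 fun t => (hθd t).continuousAt,
    strictMono_of_hasDerivAt_pos hθd fun t => ?_, by simp [hΦ, hz], fun t => ?_⟩
  · have hn : 0 < Complex.normSq (z t) := Complex.normSq_pos.2 (hz0 t)
    have h1 : (z' t).re = X' t := by simp [hz']
    have h2 : (z' t).im = Y' t := by simp [hz']
    rw [Complex.div_im, hre, him, h1, h2, ← sub_div]
    exact div_pos (by linarith [hturn t]) hn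
  · have h : z t = ((‖z 0‖ * Real.exp (Φ t).re : ℝ) : ℂ) *
        Complex.exp (((Complex.arg (z 0) + (Φ t).im : ℝ) : ℂ) * Complex.I) := by
      rw [hexp t]
      nth_rewrite 1 [← Complex.norm_mul_exp_arg_mul_I (z 0)]
      nth_rewrite 1 [← Complex.re_add_im (Φ t)]
      push_cast
      rw [add_mul, Complex.exp_add, Complex.exp_add]
      ring
    refine ⟨‖z 0‖ * Real.exp (Φ t).re, mul_pos (norm_pos_iff.2 (hz0 0)) (Real.exp_pos _), ?_, ?_⟩
    · rw [← hre, h, Complex.re_ofReal_mul, Complex.exp_ofReal_mul_I_re]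
    · rw [← him, h, Complex.im_ofReal_mul, Complex.exp_ofReal_mul_I_im]

/-- The Wronskian identities give difference quotients exactly; continuity of g alone then yields
the derivative in E, without differentiating any series. -/
lemma hasDerivAt_of_eq_add_sub_mul {f g : ℝ → ℝ} {x₀ c : ℝ} (hg : Continuous g)
    (h : ∀ x, f x = c + (x - x₀) * g x) : HasDerivAt f (g x₀) x₀ := by
  rw [hasDerivAt_iff_tendsto_slope]
  refine (hg.continuousAt.tendsto.mono_left nhdsWithin_le_nhds).congr' ?_
  filter_upwards [self_mem_nhdsWithin] with x hx
  rw [slope_def_field, h x, h x₀]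
  have : x - x₀ ≠ 0 := sub_ne_zero.2 hx
  field_simp
  ring

variable {ε μ : ℝ → ℝ}

/-- The overlap integral over the half period of two families of functions. -/
def overlap (ε : ℝ → ℝ) (u w : ℝ → ℝ → ℝ) (E E' : ℝ) : ℝ :=
  ∫ t in (0 : ℝ)..1 / 2, ε t * (u E t * w E' t)

lemma continuous_overlap (hε : IsCoefficient ε) {u w : ℝ → ℝ → ℝ}
    (hu : Continuous (Function.uncurry u)) (hw : Continuous (Function.uncurry w)) :
    Continuous fun p : ℝ × ℝ => overlap ε u w p.1 p.2 := by
  have hg : Continuous (Function.uncurry fun (p : ℝ × ℝ) t => u p.1 t * w p.2 t) :=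
    (hu.comp (by fun_prop : Continuous fun q : (ℝ × ℝ) × ℝ => (q.1.1, q.2))).mul
      (hw.comp (by fun_prop : Continuous fun q : (ℝ × ℝ) × ℝ => (q.1.2, q.2)))
  exact (hε.continuous_parametric_primitive hg).comp (Continuous.prodMk_left (1 / 2 : ℝ))

/-- The polar angles of the two fundamental solutions at the half period, as functions of the
spectral parameter. -/
structure IsAnglePair (ε μ : ℝ → ℝ) (θ φ : ℝ → ℝ) : Prop where
  continuous_fst : Continuous θ
  continuous_snd : Continuous φ
  strictMono_fst : StrictMono θ
  strictMono_snd : StrictMono φ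
  fst_zero : θ 0 = 0
  exists_le_fst : ∀ c, ∃ E, c ≤ θ E
  snd_pos : ∀ E ≤ 0, 0 < φ E
  abs_sub_lt : ∀ E, |θ E - φ E| < Real.pi / 2
  discriminant_mul : ∀ E, discriminant ε μ E * Real.cos (θ E - φ E) = Real.cos (θ E + φ E)
  lowerEntry_eq_zero : ∀ E, lowerEntry ε μ E = 0 ↔ Real.sin (θ E) * Real.cos (θ E) = 0
  upperEntry_eq_zero : ∀ E, upperEntry ε μ E = 0 ↔ Real.sin (φ E) * Real.cos (φ E) = 0

/-- The curve E ↦ (p, r) turns counterclockwise because p r' - r p' is the integral of ε times the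
square of the even solution over the half period. -/
lemma exists_angle_cosSolution (h : IsMaterial ε μ) :
    ∃ θ : ℝ → ℝ, Continuous θ ∧ StrictMono θ ∧ θ 0 = 0 ∧
      ∀ E, ∃ ρ : ℝ, 0 < ρ ∧ cosSolution ε μ E (1 / 2) = ρ * Real.cos (θ E) ∧
        E * sinSolution ε μ E (1 / 2) = ρ * Real.sin (θ E) := by
  have hu : Continuous (Function.uncurry (cosSolution ε μ)) :=
    continuous_uncurry_cosSolution h.coeff_ε h.coeff_μ
  have hw : Continuous (Function.uncurry (sinSolution μ ε)) :=
    continuous_uncurry_sinSolution h.coeff_μ h.coeff_ε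
  have hW₁ := continuous_overlap h.coeff_ε hu hu
  have hW₂ := continuous_overlap h.coeff_ε hu hw
  set W₁ := overlap ε (cosSolution ε μ) (cosSolution ε μ) with hW₁_def
  set W₂ := overlap ε (cosSolution ε μ) (sinSolution μ ε) with hW₂_def
  set p : ℝ → ℝ := fun E => cosSolution ε μ E (1 / 2) with hp
  set q : ℝ → ℝ := fun E => sinSolution μ ε E (1 / 2) with hq
  set r : ℝ → ℝ := fun E => E * sinSolution ε μ E (1 / 2) with hr
  set s : ℝ → ℝ := fun E => cosSolution μ ε E (1 / 2) with hs
  have hdet : ∀ E, p E * s E + r E * q E = 1 := fun E => cos_mul_cos_add h E (1 / 2)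
  have hw₁ : ∀ E E', r E * p E' - p E * r E' = (E - E') * W₁ E E' := fun E E' => by
    have := (cosSolution_isRealSolution h E).wronskian_eq h (cosSolution_isRealSolution h E') (1 / 2)
    simp only [cosSolution_apply_zero h.coeff_ε h.coeff_μ, sinSolution_apply_zero] at this
    simp only [hp, hr, hW₁_def, overlap]
    linarith
  have hw₂ : ∀ E E', p E * s E' + r E * q E' = 1 + (E - E') * W₂ E E' := fun E E' => by
    have := (cosSolution_isRealSolution h E).wronskian_eq h (sinSolution_isRealSolution h E') (1 / 2)
    simp only [cosSolution_apply_zero h.coeff_ε h.coeff_μ, sinSolution_apply_zero,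
      cosSolution_apply_zero h.coeff_μ h.coeff_ε] at this
    simp only [hp, hr, hq, hs, hW₂_def, overlap]
    linarith
  have hleft : ∀ {W : ℝ → ℝ → ℝ}, (Continuous fun p : ℝ × ℝ => W p.1 p.2) → ∀ E',
      Continuous fun E => W E E' := fun hW E' => hW.comp (Continuous.prodMk_left E')
  have hdiag : ∀ {W : ℝ → ℝ → ℝ}, (Continuous fun p : ℝ × ℝ => W p.1 p.2) →
      Continuous fun E => W E E := fun hW => hW.comp (continuous_id.prodMk continuous_id)
  -- Solving `hw₁` and `hw₂` at (E, E₀) for p(E), with determinant 1 from `hdet`, gives p(E) - p(E₀)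
  -- with an explicit factor E - E₀.
  have hpd : ∀ E, HasDerivAt p (W₂ E E * p E - W₁ E E * q E) E := fun E₀ => by
    refine hasDerivAt_of_eq_add_sub_mul (g := fun E => W₂ E E₀ * p E₀ - W₁ E E₀ * q E₀) (c := p E₀)
      (((hleft hW₂ E₀).mul continuous_const).sub ((hleft hW₁ E₀).mul continuous_const))
      fun E => ?_
    linear_combination (-p E) * hdet E₀ + p E₀ * hw₂ E E₀ - q E₀ * hw₁ E E₀
  have hrd : ∀ E, HasDerivAt r (W₂ E E * r E + W₁ E E * s E) E := fun E₀ => by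
    refine hasDerivAt_of_eq_add_sub_mul (g := fun E => W₂ E E₀ * r E₀ + W₁ E E₀ * s E₀) (c := r E₀)
      (((hleft hW₂ E₀).mul continuous_const).add ((hleft hW₁ E₀).mul continuous_const))
      fun E => ?_
    linear_combination (-r E) * hdet E₀ + r E₀ * hw₂ E E₀ + s E₀ * hw₁ E E₀
  have hhalf : ∀ {f : ℝ → ℝ → ℝ}, Continuous (Function.uncurry f) → Continuous fun E => f E (1 / 2) :=
    fun hf => hf.comp (Continuous.prodMk_left (1 / 2 : ℝ))
  have hpc : Continuous p := hhalf hu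
  have hqc : Continuous q := hhalf hw
  have hrc : Continuous r :=
    continuous_id.mul (hhalf (continuous_uncurry_sinSolution h.coeff_ε h.coeff_μ))
  have hsc : Continuous s := hhalf (continuous_uncurry_cosSolution h.coeff_μ h.coeff_ε)
  obtain ⟨θ, hθc, hθm, hθ0, hθ⟩ := exists_strictMono_angle hpd hrd
    (((hdiag hW₂).mul hpc).sub ((hdiag hW₁).mul hqc))
    (((hdiag hW₂).mul hrc).add ((hdiag hW₁).mul hsc)) fun E => by
      have hpos : 0 < W₁ E E := (cosSolution_isRealSolution h E).integral_sq_pos h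
        (Or.inl (by rw [cosSolution_apply_zero h.coeff_ε h.coeff_μ]; exact one_ne_zero)) (by norm_num)
      have : p E * (W₂ E E * r E + W₁ E E * s E) - r E * (W₂ E E * p E - W₁ E E * q E)
          = W₁ E E := by linear_combination W₁ E E * hdet E
      rwa [this]
  refine ⟨θ, hθc, hθm, ?_, hθ⟩
  have hp0 := one_le_cosSolution h.coeff_ε h.coeff_μ h.ε_pos h.μ_pos le_rfl
    (show (0 : ℝ) ≤ 1 / 2 by norm_num)
  rw [hθ0, show r 0 = 0 from zero_mul _, Complex.ofReal_zero, zero_mul, add_zero]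
  exact Complex.arg_ofReal_of_nonneg (zero_le_one.trans hp0)

/-- As for the even solution: s q' - q s' is the integral of ε times the square of the odd solution.
At E = 0 both s and q are positive, which places the initial angle in the open first quadrant. -/
lemma exists_angle_sinSolution (h : IsMaterial ε μ) :
    ∃ φ : ℝ → ℝ, Continuous φ ∧ StrictMono φ ∧ 0 < φ 0 ∧ φ 0 < Real.pi / 2 ∧
      ∀ E, ∃ σ : ℝ, 0 < σ ∧ cosSolution μ ε E (1 / 2) = σ * Real.cos (φ E) ∧
        sinSolution μ ε E (1 / 2) = σ * Real.sin (φ E) := by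
  have hu : Continuous (Function.uncurry (cosSolution ε μ)) :=
    continuous_uncurry_cosSolution h.coeff_ε h.coeff_μ
  have hw : Continuous (Function.uncurry (sinSolution μ ε)) :=
    continuous_uncurry_sinSolution h.coeff_μ h.coeff_ε
  have hW₁ := continuous_overlap h.coeff_ε hw hu
  have hW₂ := continuous_overlap h.coeff_ε hw hw
  set W₁ := overlap ε (sinSolution μ ε) (cosSolution ε μ) with hW₁_def
  set W₂ := overlap ε (sinSolution μ ε) (sinSolution μ ε) with hW₂_def
  set p : ℝ → ℝ := fun E => cosSolution ε μ E (1 / 2) with hp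
  set q : ℝ → ℝ := fun E => sinSolution μ ε E (1 / 2) with hq
  set r : ℝ → ℝ := fun E => E * sinSolution ε μ E (1 / 2) with hr
  set s : ℝ → ℝ := fun E => cosSolution μ ε E (1 / 2) with hs
  have hdet : ∀ E, p E * s E + r E * q E = 1 := fun E => cos_mul_cos_add h E (1 / 2)
  have hw₁ : ∀ E E', q E * r E' + s E * p E' = 1 - (E - E') * W₁ E E' := fun E E' => by
    have := (sinSolution_isRealSolution h E).wronskian_eq h (cosSolution_isRealSolution h E') (1 / 2)
    simp only [cosSolution_apply_zero h.coeff_ε h.coeff_μ, sinSolution_apply_zero,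
      cosSolution_apply_zero h.coeff_μ h.coeff_ε] at this
    simp only [hp, hr, hq, hs, hW₁_def, overlap]
    linarith
  have hw₂ : ∀ E E', q E * s E' - s E * q E' = (E - E') * W₂ E E' := fun E E' => by
    have := (sinSolution_isRealSolution h E).wronskian_eq h (sinSolution_isRealSolution h E') (1 / 2)
    simp only [sinSolution_apply_zero, cosSolution_apply_zero h.coeff_μ h.coeff_ε] at this
    simp only [hq, hs, hW₂_def, overlap]
    linarith
  have hleft : ∀ {W : ℝ → ℝ → ℝ}, (Continuous fun p : ℝ × ℝ => W p.1 p.2) → ∀ E',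
      Continuous fun E => W E E' := fun hW E' => hW.comp (Continuous.prodMk_left E')
  have hdiag : ∀ {W : ℝ → ℝ → ℝ}, (Continuous fun p : ℝ × ℝ => W p.1 p.2) →
      Continuous fun E => W E E := fun hW => hW.comp (continuous_id.prodMk continuous_id)
  have hqd : ∀ E, HasDerivAt q (W₂ E E * p E - W₁ E E * q E) E := fun E₀ => by
    refine hasDerivAt_of_eq_add_sub_mul (g := fun E => W₂ E E₀ * p E₀ - W₁ E E₀ * q E₀) (c := q E₀)
      (((hleft hW₂ E₀).mul continuous_const).sub ((hleft hW₁ E₀).mul continuous_const))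
      fun E => ?_
    linear_combination (-q E) * hdet E₀ + q E₀ * hw₁ E E₀ + p E₀ * hw₂ E E₀
  have hsd : ∀ E, HasDerivAt s (-(W₂ E E * r E) - W₁ E E * s E) E := fun E₀ => by
    refine hasDerivAt_of_eq_add_sub_mul (g := fun E => -(W₂ E E₀ * r E₀) - W₁ E E₀ * s E₀)
      (c := s E₀)
      (((hleft hW₂ E₀).mul continuous_const).neg.sub ((hleft hW₁ E₀).mul continuous_const))
      fun E => ?_
    linear_combination (-s E) * hdet E₀ + s E₀ * hw₁ E E₀ - r E₀ * hw₂ E E₀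
  have hhalf : ∀ {f : ℝ → ℝ → ℝ}, Continuous (Function.uncurry f) → Continuous fun E => f E (1 / 2) :=
    fun hf => hf.comp (Continuous.prodMk_left (1 / 2 : ℝ))
  have hpc : Continuous p := hhalf hu
  have hqc : Continuous q := hhalf hw
  have hrc : Continuous r :=
    continuous_id.mul (hhalf (continuous_uncurry_sinSolution h.coeff_ε h.coeff_μ))
  have hsc : Continuous s := hhalf (continuous_uncurry_cosSolution h.coeff_μ h.coeff_ε)
  obtain ⟨φ, hφc, hφm, hφ0, hφ⟩ := exists_strictMono_angle hsd hqd
    (((hdiag hW₂).mul hrc).neg.sub ((hdiag hW₁).mul hsc))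
    (((hdiag hW₂).mul hpc).sub ((hdiag hW₁).mul hqc)) fun E => by
      have hpos : 0 < W₂ E E := (sinSolution_isRealSolution h E).integral_sq_pos h
        (Or.inr (by rw [cosSolution_apply_zero h.coeff_μ h.coeff_ε]; exact one_ne_zero)) (by norm_num)
      have : s E * (W₂ E E * p E - W₁ E E * q E) - q E * (-(W₂ E E * r E) - W₁ E E * s E)
          = W₂ E E := by linear_combination W₂ E E * hdet E
      rwa [this]
  have hs0 : 0 < s 0 := zero_lt_one.trans_le <|
    one_le_cosSolution h.coeff_μ h.coeff_ε h.μ_pos h.ε_pos le_rfl (by norm_num)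
  have hq0 : 0 < q 0 := sinSolution_pos h.coeff_μ h.coeff_ε h.μ_pos h.ε_pos le_rfl (by norm_num)
  have hlt : |φ 0| < Real.pi / 2 := by
    rw [hφ0, Complex.abs_arg_lt_pi_div_two_iff]
    left; simpa using hs0
  refine ⟨φ, hφc, hφm, ?_, (abs_lt.1 hlt).2, hφ⟩
  obtain ⟨σ, hσ, -, h2⟩ := hφ 0
  by_contra! hle
  have := Real.sin_nonpos_of_nonpos_of_neg_pi_le hle (by linarith [(abs_lt.1 hlt).1, Real.pi_pos])
  rw [h2] at hq0
  linarith [mul_nonpos_of_nonneg_of_nonpos hσ.le this]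

/-! ### Unboundedness of the angles, by a scaled Prüfer transformation. -/

lemma IsCoefficient.inf {a b : ℝ → ℝ} (ha : IsCoefficient a) (hb : IsCoefficient b) :
    IsCoefficient fun x => min (a x) (b x) := by
  refine ⟨?_, ha.aestronglyMeasurable.inf hb.aestronglyMeasurable,
    (ha.countable.union hb.countable).mono fun x hx => ?_⟩
  · obtain ⟨K, hK, hKa⟩ := ha.bounded
    obtain ⟨L, -, hLb⟩ := hb.bounded
    refine ⟨max K L, hK.trans (le_max_left _ _), fun x => ?_⟩
    rcases min_choice (a x) (b x) with h | h <;> rw [h]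
    exacts [(hKa x).trans (le_max_left _ _), (hLb x).trans (le_max_right _ _)]
  · by_contra hcon
    rw [mem_union, not_or] at hcon
    exact hx ((not_not.1 hcon.1).min (not_not.1 hcon.2))

/-- By the determinant identity, a zero of the even solution forces E and its flux to be nonzero.
The weight c is used as s² and as s³, with E = s². -/
lemma cos_sq_add_sin_sq_pos (h : IsMaterial ε μ) {c E : ℝ} (hc : 0 ≤ c) (hcE : c = 0 → E = 0)
    (x : ℝ) : 0 < cosSolution ε μ E x ^ 2 + c * sinSolution ε μ E x ^ 2 := by
  have hw := cos_mul_cos_add h E x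
  by_cases hp : cosSolution ε μ E x = 0
  · rw [hp, zero_mul, zero_add] at hw
    have hE : E ≠ 0 := by rintro rfl; simp at hw
    have hS : sinSolution ε μ E x ≠ 0 := by intro h0; simp [h0] at hw
    have hc' : 0 < c := hc.lt_of_ne fun h0 => hE (hcE h0.symm)
    positivity
  · positivity

/-- The scaled polar angle at `x`, with `s ^ 2` the spectral parameter. -/
def scaledAngle (ε μ : ℝ → ℝ) (s x : ℝ) : ℝ :=
  (∫ t in (0 : ℝ)..x, ε t * (s * cosSolution ε μ (s ^ 2) t ^ 2 /
    (cosSolution ε μ (s ^ 2) t ^ 2 + s ^ 2 * sinSolution ε μ (s ^ 2) t ^ 2))) +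
  ∫ t in (0 : ℝ)..x, μ t * (s * (s ^ 2 * sinSolution ε μ (s ^ 2) t ^ 2) /
    (cosSolution ε μ (s ^ 2) t ^ 2 + s ^ 2 * sinSolution ε μ (s ^ 2) t ^ 2))

lemma continuous_scaled (h : IsMaterial ε μ) :
    Continuous (fun q : ℝ × ℝ => cosSolution ε μ (q.1 ^ 2) q.2) ∧
    Continuous (fun q : ℝ × ℝ => sinSolution ε μ (q.1 ^ 2) q.2) :=
  ⟨(continuous_uncurry_cosSolution h.coeff_ε h.coeff_μ).comp
      (by fun_prop : Continuous fun q : ℝ × ℝ => (q.1 ^ 2, q.2)),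
    (continuous_uncurry_sinSolution h.coeff_ε h.coeff_μ).comp
      (by fun_prop : Continuous fun q : ℝ × ℝ => (q.1 ^ 2, q.2))⟩

lemma scaled_sq_add_sq_pos (h : IsMaterial ε μ) (s x : ℝ) :
    0 < cosSolution ε μ (s ^ 2) x ^ 2 + s ^ 2 * sinSolution ε μ (s ^ 2) x ^ 2 :=
  cos_sq_add_sin_sq_pos h (sq_nonneg s) (fun h0 => h0) x

lemma continuous_uncurry_scaledAngle (h : IsMaterial ε μ) :
    Continuous (Function.uncurry (scaledAngle ε μ)) := by
  obtain ⟨hC, hS⟩ := continuous_scaled h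
  have hD := (hC.pow 2).add ((continuous_fst.pow 2).mul (hS.pow 2))
  refine Continuous.add (h.coeff_ε.continuous_parametric_primitive (X := ℝ)
      (g := fun s t => s * cosSolution ε μ (s ^ 2) t ^ 2 / (cosSolution ε μ (s ^ 2) t ^ 2
        + s ^ 2 * sinSolution ε μ (s ^ 2) t ^ 2)) ?_)
    (h.coeff_μ.continuous_parametric_primitive (X := ℝ)
      (g := fun s t => s * (s ^ 2 * sinSolution ε μ (s ^ 2) t ^ 2) /
        (cosSolution ε μ (s ^ 2) t ^ 2 + s ^ 2 * sinSolution ε μ (s ^ 2) t ^ 2)) ?_)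
  · exact (continuous_fst.mul (hC.pow 2)).div hD fun q => (scaled_sq_add_sq_pos h q.1 q.2).ne'
  · exact (continuous_fst.mul ((continuous_fst.pow 2).mul (hS.pow 2))).div hD
      fun q => (scaled_sq_add_sq_pos h q.1 q.2).ne'

/-- For z = C + isS, the functions κ and ζ are primitives in x of the real and imaginary parts of
z'/z. Hence z e^{-κ-iζ} is constant, being continuous with zero derivative off a countable set. -/
lemma exists_eq_mul_scaledAngle (h : IsMaterial ε μ) (s x : ℝ) : ∃ ρ : ℝ, 0 < ρ ∧
    cosSolution ε μ (s ^ 2) x = ρ * Real.cos (scaledAngle ε μ s x) ∧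
    s * sinSolution ε μ (s ^ 2) x = ρ * Real.sin (scaledAngle ε μ s x) := by
  set C : ℝ → ℝ := cosSolution ε μ (s ^ 2) with hC
  set S : ℝ → ℝ := sinSolution ε μ (s ^ 2) with hS
  have hCc : Continuous C := continuous_cosSolution h.coeff_ε h.coeff_μ _
  have hSc : Continuous S := continuous_sinSolution h.coeff_ε h.coeff_μ _
  have hDpos : ∀ t, 0 < C t ^ 2 + s ^ 2 * S t ^ 2 := scaled_sq_add_sq_pos h s
  have hquot : ∀ {f : ℝ → ℝ}, Continuous f →
      Continuous fun t => f t / (C t ^ 2 + s ^ 2 * S t ^ 2) := fun hf =>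
    hf.div ((hCc.pow 2).add (continuous_const.mul (hSc.pow 2))) fun t => (hDpos t).ne'
  have hg : Continuous fun t => s ^ 2 * S t * C t / (C t ^ 2 + s ^ 2 * S t ^ 2) :=
    hquot ((continuous_const.mul hSc).mul hCc)
  have hf₁ : Continuous fun t => s * C t ^ 2 / (C t ^ 2 + s ^ 2 * S t ^ 2) :=
    hquot (continuous_const.mul (hCc.pow 2))
  have hf₂ : Continuous fun t => s * (s ^ 2 * S t ^ 2) / (C t ^ 2 + s ^ 2 * S t ^ 2) :=
    hquot (continuous_const.mul (continuous_const.mul (hSc.pow 2)))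
  set κ : ℝ → ℝ := fun x =>
    (∫ t in (0 : ℝ)..x, ε t * (s ^ 2 * S t * C t / (C t ^ 2 + s ^ 2 * S t ^ 2))) -
    ∫ t in (0 : ℝ)..x, μ t * (s ^ 2 * S t * C t / (C t ^ 2 + s ^ 2 * S t ^ 2)) with hκ
  set ζ : ℝ → ℝ := scaledAngle ε μ s with hζ
  have hκc : Continuous κ :=
    (h.coeff_ε.continuous_primitive hg).sub (h.coeff_μ.continuous_primitive hg)
  have hζc : Continuous ζ :=
    (h.coeff_ε.continuous_primitive hf₁).add (h.coeff_μ.continuous_primitive hf₂)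
  set F : ℝ → ℂ := fun t => (C t + (s * S t : ℝ) * Complex.I) *
    Complex.exp (-((κ t : ℂ) + ζ t * Complex.I)) with hF
  have hFc : Continuous F := by
    have := Complex.continuous_ofReal
    exact ((this.comp hCc).add ((this.comp (continuous_const.mul hSc)).mul continuous_const)).mul
      (Complex.continuous_exp.comp ((this.comp hκc).add
        ((this.comp hζc).mul continuous_const)).neg)
  have hFd : ∀ t, ContinuousAt ε t ∧ ContinuousAt μ t → HasDerivAt F 0 t := by
    rintro t ⟨h1, h2⟩
    have dz : HasDerivAt (fun t => (C t : ℂ) + (s * S t : ℝ) * Complex.I)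
        ((-(s ^ 2 * (μ t * S t)) : ℝ) + (s * (ε t * C t) : ℝ) * Complex.I) t :=
      (hasDerivAt_cosSolution h.coeff_ε h.coeff_μ (s ^ 2) h2).ofReal_comp.add
        (((hasDerivAt_sinSolution h.coeff_ε h.coeff_μ (s ^ 2) h1).const_mul
          s).ofReal_comp.mul_const Complex.I)
    have dW : HasDerivAt (fun t => -((κ t : ℂ) + ζ t * Complex.I)) _ t :=
      (((h.coeff_ε.hasDerivAt_primitive hg h1).sub
        (h.coeff_μ.hasDerivAt_primitive hg h2)).ofReal_comp.add
        (((h.coeff_ε.hasDerivAt_primitive hf₁ h1).add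
          (h.coeff_μ.hasDerivAt_primitive hf₂ h2)).ofReal_comp.mul_const Complex.I)).neg
    refine (dz.mul dW.cexp).congr_deriv ?_
    have hD : (C t : ℂ) ^ 2 + s ^ 2 * S t ^ 2 ≠ 0 := by exact_mod_cast (hDpos t).ne'
    rw [mul_left_comm _ (Complex.exp _), mul_comm _ (Complex.exp _), ← mul_add]
    refine mul_eq_zero_of_right _ ?_
    push_cast
    field_simp
    linear_combination (-(s : ℂ) ^ 2 * S t * (ε t * C t ^ 2 + μ t * s ^ 2 * S t ^ 2))
      * Complex.I_sq
  have hconst : F x = 1 := by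
    have := integral_eq_of_hasDerivAt_off_countable F (fun _ => 0) (a := 0) (b := x) h.countable
      hFc.continuousOn (fun t ht => hFd t (not_not.1 ht.2)) intervalIntegrable_const
    rw [intervalIntegral.integral_zero] at this
    rw [sub_eq_zero.1 this.symm]
    simp [hF, hκ, hζ, scaledAngle, hC, hS, cosSolution_apply_zero h.coeff_ε h.coeff_μ,
      sinSolution_apply_zero]
  have hz : (C x : ℂ) + (s * S x : ℝ) * Complex.I =
      (Real.exp (κ x) : ℝ) * Complex.exp ((ζ x : ℂ) * Complex.I) := by
    rw [Complex.ofReal_exp, ← Complex.exp_add]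
    have := congrArg (· * Complex.exp ((κ x : ℂ) + ζ x * Complex.I)) hconst
    simpa only [hF, mul_assoc, ← Complex.exp_add, neg_add_cancel, Complex.exp_zero, mul_one,
      one_mul] using this
  refine ⟨Real.exp (κ x), Real.exp_pos _, ?_, ?_⟩
  · have := congrArg Complex.re hz
    rw [Complex.re_ofReal_mul, Complex.exp_ofReal_mul_I_re] at this
    simpa using this
  · have := congrArg Complex.im hz
    rw [Complex.im_ofReal_mul, Complex.exp_ofReal_mul_I_im] at this
    simpa using this

/-- The angular speed is s times a weighted average of ε and μ, hence at least s min(ε, μ). -/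
lemma mul_integral_min_le_scaledAngle (h : IsMaterial ε μ) {s : ℝ} (hs : 0 ≤ s) {x : ℝ}
    (hx : 0 ≤ x) : s * ∫ t in (0 : ℝ)..x, min (ε t) (μ t) * 1 ≤ scaledAngle ε μ s x := by
  obtain ⟨hC, hS⟩ := continuous_scaled h
  have hCs := hC.comp (Continuous.prodMk_right s)
  have hSs := hS.comp (Continuous.prodMk_right s)
  have hD := (hCs.pow 2).add ((continuous_const (y := s ^ 2)).mul (hSs.pow 2))
  have i₁ := h.coeff_ε.intervalIntegrable_mul
    (((continuous_const (y := s)).mul (hCs.pow 2)).div hD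
      fun t => (scaled_sq_add_sq_pos h s t).ne') 0 x
  have i₂ := h.coeff_μ.intervalIntegrable_mul
    (((continuous_const (y := s)).mul ((continuous_const (y := s ^ 2)).mul (hSs.pow 2))).div hD
      fun t => (scaled_sq_add_sq_pos h s t).ne') 0 x
  refine le_of_le_of_eq ?_ (intervalIntegral.integral_add i₁ i₂)
  rw [← intervalIntegral.integral_const_mul]
  refine intervalIntegral.integral_mono_on hx
    (((h.coeff_ε.inf h.coeff_μ).intervalIntegrable_mul continuous_const 0 x).const_mul s)
    (i₁.add i₂) fun t _ => ?_
  have hDt := scaled_sq_add_sq_pos h s t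
  change _ ≤ ε t * (s * cosSolution ε μ (s ^ 2) t ^ 2 / (cosSolution ε μ (s ^ 2) t ^ 2
      + s ^ 2 * sinSolution ε μ (s ^ 2) t ^ 2)) +
    μ t * (s * (s ^ 2 * sinSolution ε μ (s ^ 2) t ^ 2) / (cosSolution ε μ (s ^ 2) t ^ 2
      + s ^ 2 * sinSolution ε μ (s ^ 2) t ^ 2))
  set c := cosSolution ε μ (s ^ 2) t ^ 2
  set d := s ^ 2 * sinSolution ε μ (s ^ 2) t ^ 2 with hd
  have hc0 : 0 ≤ c := sq_nonneg _
  have hd0 : 0 ≤ d := by positivity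
  have e : s * (min (ε t) (μ t) * 1) =
      min (ε t) (μ t) * (s * c / (c + d)) + min (ε t) (μ t) * (s * d / (c + d)) := by
    field_simp
  rw [e]
  gcongr
  exacts [min_le_left _ _, min_le_right _ _]

/-- The angle of the first solution at the half period is unbounded. -/
lemma exists_le_angle (h : IsMaterial ε μ) {θ : ℝ → ℝ} (hθc : Continuous θ) (hθ0 : θ 0 = 0)
    (hθ : ∀ E, ∃ ρ : ℝ, 0 < ρ ∧ cosSolution ε μ E (1 / 2) = ρ * Real.cos (θ E) ∧
      E * sinSolution ε μ E (1 / 2) = ρ * Real.sin (θ E)) (c : ℝ) : ∃ E, c ≤ θ E := by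
  set ζ : ℝ → ℝ := fun s => scaledAngle ε μ s (1 / 2) with hζ
  have hζc : Continuous ζ :=
    (continuous_uncurry_scaledAngle h).comp (Continuous.prodMk_left (1 / 2 : ℝ))
  -- The vectors (C, sS) and (C, s²S) have inner product C² + s³S² > 0, so their angles never differ
  -- by π/2; both angles start at 0.
  have hcos : ∀ s, 0 ≤ s → 0 < Real.cos (ζ s - θ (s ^ 2)) := by
    intro s hs
    obtain ⟨ρ, hρ, h1, h2⟩ := hθ (s ^ 2)
    obtain ⟨σ, hσ, h3, h4⟩ := exists_eq_mul_scaledAngle h s (1 / 2)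
    have hpos := cos_sq_add_sin_sq_pos h (c := s ^ 3) (E := s ^ 2) (by positivity)
      (fun h0 => by rw [pow_eq_zero_iff three_ne_zero |>.1 h0]; simp) (1 / 2)
    have e : cosSolution ε μ (s ^ 2) (1 / 2) ^ 2 + s ^ 3 * sinSolution ε μ (s ^ 2) (1 / 2) ^ 2 =
        σ * ρ * Real.cos (ζ s - θ (s ^ 2)) := by
      have e1 : cosSolution ε μ (s ^ 2) (1 / 2) ^ 2 =
          (σ * Real.cos (ζ s)) * (ρ * Real.cos (θ (s ^ 2))) := by
        rw [sq]; nth_rewrite 1 [h3]; rw [h1]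
      have e2 : s ^ 3 * sinSolution ε μ (s ^ 2) (1 / 2) ^ 2 =
          (σ * Real.sin (ζ s)) * (ρ * Real.sin (θ (s ^ 2))) := by
        rw [← h2, ← h4]; ring
      rw [e1, e2, Real.cos_sub]; ring
    rw [e] at hpos
    exact pos_of_mul_pos_right hpos (by positivity)
  have hlt : ∀ s, 0 ≤ s → ζ s - θ (s ^ 2) < Real.pi / 2 := by
    intro s hs
    by_contra! hge
    have hcont : Continuous fun s => ζ s - θ (s ^ 2) := hζc.sub (hθc.comp (continuous_pow 2))
    have h0 : ζ 0 - θ (0 ^ 2) = 0 := by simp [hζ, scaledAngle, hθ0]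
    obtain ⟨s₁, hs₁, he⟩ := intermediate_value_Icc hs hcont.continuousOn
      (show Real.pi / 2 ∈ Icc _ _ from ⟨by rw [h0]; exact Real.pi_div_two_pos.le, hge⟩)
    have := hcos s₁ hs₁.1
    simp only at he
    rw [he, Real.cos_pi_div_two] at this
    exact this.false
  have hI : 0 < ∫ t in (0 : ℝ)..1 / 2, min (ε t) (μ t) * 1 :=
    (h.coeff_ε.inf h.coeff_μ).primitive_pos (fun x => lt_min (h.ε_pos x) (h.μ_pos x))
      continuous_const (fun _ _ => one_pos) (by norm_num)
  set I := ∫ t in (0 : ℝ)..1 / 2, min (ε t) (μ t) * 1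
  set s := (|c| + Real.pi / 2) / I
  have hs : 0 ≤ s := div_nonneg (by positivity) hI.le
  have h1 := mul_integral_min_le_scaledAngle h hs (show (0 : ℝ) ≤ 1 / 2 by norm_num)
  have h2 : s * I = |c| + Real.pi / 2 := div_mul_cancel₀ _ hI.ne'
  refine ⟨s ^ 2, ?_⟩
  have h3 := hlt s hs
  have h4 : s * I ≤ ζ s := h1
  linarith [le_abs_self c]

/-- Writing (p, r) and (s, q) in polar form turns ps + qr = 1 into ρσ cos(θ - φ) = 1. So cos(θ - φ)
never vanishes, and continuity from E = 0 keeps |θ - φ| below π/2. -/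
lemma exists_isAnglePair (h : IsMaterial ε μ) : ∃ θ φ, IsAnglePair ε μ θ φ := by
  obtain ⟨θ, hθc, hθm, hθ0, hθ⟩ := exists_angle_cosSolution h
  obtain ⟨φ, hφc, hφm, hφ0, hφ0', hφ⟩ := exists_angle_sinSolution h
  refine ⟨θ, φ, hθc, hφc, hθm, hφm, hθ0, exists_le_angle h hθc hθ0 hθ, fun E hE => ?_, fun E => ?_, fun E => ?_, fun E => ?_,
    fun E => ?_⟩
  · by_contra! hle
    obtain ⟨E₁, hE₁, h0⟩ := intermediate_value_Icc hE hφc.continuousOn ⟨hle, hφ0.le⟩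
    obtain ⟨σ, -, -, h2⟩ := hφ E₁
    have := sinSolution_pos h.coeff_μ h.coeff_ε h.μ_pos h.ε_pos hE₁.2
      (show (0 : ℝ) < 1 / 2 by norm_num)
    rw [h2, h0, Real.sin_zero, mul_zero] at this
    exact this.false
  · have hne : ∀ E, Real.cos (θ E - φ E) ≠ 0 := fun E h0 => by
      obtain ⟨ρ, -, h1, h2⟩ := hθ E
      obtain ⟨σ, -, h3, h4⟩ := hφ E
      have hw := cos_mul_cos_add h E (1 / 2)
      rw [h1, h2, h3, h4] at hw
      rw [Real.cos_sub] at h0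
      have : (0 : ℝ) = 1 := by linear_combination hw - ρ * σ * h0
      exact zero_ne_one this
    have hc : Continuous fun E => |θ E - φ E| := (hθc.sub hφc).abs
    by_contra! hge
    have h0 : |θ 0 - φ 0| ≤ Real.pi / 2 := by
      rw [hθ0, zero_sub, abs_neg, abs_of_pos hφ0]; exact hφ0'.le
    obtain ⟨E₁, -, h1⟩ := isPreconnected_univ.intermediate_value (mem_univ 0) (mem_univ E)
      hc.continuousOn ⟨h0, hge⟩
    apply hne E₁
    rw [← Real.cos_abs]
    simp only at h1
    rw [h1, Real.cos_pi_div_two]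
  · obtain ⟨ρ, -, h1, h2⟩ := hθ E
    obtain ⟨σ, -, h3, h4⟩ := hφ E
    have hw := cos_mul_cos_add h E (1 / 2)
    rw [discriminant, Real.cos_sub, Real.cos_add]
    rw [h1, h2, h3, h4] at hw ⊢
    linear_combination (Real.cos (θ E) * Real.cos (φ E) - Real.sin (θ E) * Real.sin (φ E)) * hw
  · obtain ⟨ρ, hρ, h1, h2⟩ := hθ E
    have : lowerEntry ε μ E = (-2 * ρ ^ 2) * (Real.sin (θ E) * Real.cos (θ E)) := by
      rw [lowerEntry, neg_mul, h1, h2]; ring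
    rw [this, mul_eq_zero, or_iff_right (by simp [hρ.ne'])]
  · obtain ⟨σ, hσ, h1, h2⟩ := hφ E
    have : upperEntry ε μ E = (2 * σ ^ 2) * (Real.sin (φ E) * Real.cos (φ E)) := by
      rw [upperEntry, h1, h2]; ring
    rw [this, mul_eq_zero, or_iff_right (by simp [hσ.ne'])]

end Angles

/-! ### Quadrants and the counting of eigenvalues. -/

open Real (cos sin)

section Counting

lemma exists_common_quadrant {x y : ℝ} (hd : |x - y| < Real.pi / 2)
    (hc : |cos (x + y)| ≤ cos (x - y)) : ∃ i : ℤ,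
      x ∈ Icc (i * (Real.pi / 2)) ((i + 1) * (Real.pi / 2)) ∧
      y ∈ Icc (i * (Real.pi / 2)) ((i + 1) * (Real.pi / 2)) := by
  wlog hxy : x ≤ y generalizing x y
  · obtain ⟨i, h1, h2⟩ := this (x := y) (y := x) (by rwa [abs_sub_comm])
      (by rwa [add_comm, ← Real.cos_neg (y - x), neg_sub]) (not_le.1 hxy).le
    exact ⟨i, h2, h1⟩
  have hpi : 0 < Real.pi / 2 := by linarith [Real.pi_pos]
  have h1 : (⌊x / (Real.pi / 2)⌋ : ℝ) * (Real.pi / 2) ≤ x := (le_div_iff₀ hpi).1 (Int.floor_le _)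
  have h2 : x < ((⌊x / (Real.pi / 2)⌋ : ℝ) + 1) * (Real.pi / 2) :=
    (div_lt_iff₀ hpi).1 (Int.lt_floor_add_one _)
  refine ⟨⌊x / (Real.pi / 2)⌋, ⟨h1, h2.le⟩, h1.trans hxy, ?_⟩
  set i := ⌊x / (Real.pi / 2)⌋
  by_contra! hgt
  have hd' := (abs_lt.1 hd).1
  -- If y passed the axis that bounds the quadrant of x, the shifted sines would have opposite
  -- signs, making the cosine of the sum exceed that of the difference. The shift changes cos(x + y)
  -- only by a sign, which the absolute value absorbs.
  have hs1 : sin (x - (i + 1) * (Real.pi / 2)) < 0 :=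
    Real.sin_neg_of_neg_of_neg_pi_lt (by linarith) (by linarith)
  have hs2 : 0 < sin (y - (i + 1) * (Real.pi / 2)) :=
    Real.sin_pos_of_pos_of_lt_pi (by linarith) (by linarith)
  have hprod := mul_neg_of_neg_of_pos hs1 hs2
  have e1 : cos (x - y) = cos ((x - (i + 1) * (Real.pi / 2)) - (y - (i + 1) * (Real.pi / 2))) := by
    congr 1; ring
  have e2 : cos ((x - (i + 1) * (Real.pi / 2)) + (y - (i + 1) * (Real.pi / 2))) =
      (-1) ^ (i + 1) * cos (x + y) := by
    rw [← Real.cos_sub_int_mul_pi]; congr 1; push_cast; ring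
  have e3 : cos ((x - (i + 1) * (Real.pi / 2)) + (y - (i + 1) * (Real.pi / 2))) ≤ cos (x - y) := by
    refine (le_abs_self _).trans ?_
    rw [e2, abs_mul, abs_zpow, abs_neg, abs_one, one_zpow, one_mul]
    exact hc
  rw [e1, Real.cos_add (x - _), Real.cos_sub (x - _) (y - _)] at e3
  linarith

lemma sin_mul_cos_eq_zero_iff {x : ℝ} : sin x * cos x = 0 ↔ ∃ n : ℤ, x = n * (Real.pi / 2) := by
  have : sin x * cos x = 0 ↔ sin (2 * x) = 0 := by
    rw [Real.sin_two_mul, mul_assoc, mul_eq_zero (a := 2), or_iff_right two_ne_zero]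
  rw [this, Real.sin_eq_zero_iff]
  exact exists_congr fun n => ⟨fun h => by linarith, fun h => by linarith⟩

lemma sin_mul_cos_ne_zero {x : ℝ} {n : ℤ} (h1 : n * (Real.pi / 2) < x) (h2 : x < (n + 1) * (Real.pi / 2)) :
    sin x * cos x ≠ 0 := by
  rw [Ne, sin_mul_cos_eq_zero_iff]
  rintro ⟨m, rfl⟩
  have hpi : 0 < Real.pi / 2 := by linarith [Real.pi_pos]
  have h3 : n < m := by exact_mod_cast lt_of_mul_lt_mul_right h1 hpi.le
  have h4 : m < n + 1 := by exact_mod_cast lt_of_mul_lt_mul_right h2 hpi.le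
  omega

variable {ε μ θ φ : ℝ → ℝ}

/-- `x` is the `i`-th eigenvalue at wavenumber `k`, counting from zero: both angles lie in the
`i`-th closed quadrant. -/
structure IsNthEnergy (ε μ θ φ : ℝ → ℝ) (k : ℝ) (i : ℕ) (x : ℝ) : Prop where
  fst_mem : θ x ∈ Icc (i * (Real.pi / 2)) ((i + 1) * (Real.pi / 2))
  snd_mem : φ x ∈ Icc (i * (Real.pi / 2)) ((i + 1) * (Real.pi / 2))
  discriminant_eq : discriminant ε μ x = cos k

namespace IsAnglePair

lemma cos_sub_pos (h : IsAnglePair ε μ θ φ) (x : ℝ) : 0 < cos (θ x - φ x) :=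
  Real.cos_pos_of_mem_Ioo ⟨(abs_lt.1 (h.abs_sub_lt x)).1, (abs_lt.1 (h.abs_sub_lt x)).2⟩

lemma continuous_discriminant (h : IsAnglePair ε μ θ φ) : Continuous (discriminant ε μ) := by
  have : discriminant ε μ = fun x => cos (θ x + φ x) / cos (θ x - φ x) :=
    funext fun x => by rw [eq_div_iff (h.cos_sub_pos x).ne', h.discriminant_mul]
  rw [this]
  exact (Real.continuous_cos.comp (h.continuous_fst.add h.continuous_snd)).div
    (Real.continuous_cos.comp (h.continuous_fst.sub h.continuous_snd))
    fun x => (h.cos_sub_pos x).ne'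

lemma cos_sub_eq (i : ℕ) (x : ℝ) : cos (θ x - φ x) =
    cos (θ x - i * (Real.pi / 2)) * cos (φ x - i * (Real.pi / 2))
      + sin (θ x - i * (Real.pi / 2)) * sin (φ x - i * (Real.pi / 2)) := by
  rw [← Real.cos_sub]; congr 1; ring

lemma signed_discriminant_mul (h : IsAnglePair ε μ θ φ) (i : ℕ) (x : ℝ) :
    (-1) ^ i * discriminant ε μ x * (cos (θ x - i * (Real.pi / 2)) * cos (φ x - i * (Real.pi / 2))
      + sin (θ x - i * (Real.pi / 2)) * sin (φ x - i * (Real.pi / 2))) =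
    cos (θ x - i * (Real.pi / 2)) * cos (φ x - i * (Real.pi / 2))
      - sin (θ x - i * (Real.pi / 2)) * sin (φ x - i * (Real.pi / 2)) := by
  rw [← cos_sub_eq, mul_assoc, h.discriminant_mul, ← Real.cos_add, ← Real.cos_sub_nat_mul_pi]
  congr 1; ring

/-- With C and S the products of the shifted cosines and sines, the signed discriminant is (C -
S)/(C + S). Inside one quadrant C decreases and S increases strictly. -/
lemma signed_discriminant_lt (h : IsAnglePair ε μ θ φ) {i : ℕ} {x x' : ℝ} (hx : x < x')
    (h1 : i * (Real.pi / 2) ≤ θ x) (h2 : i * (Real.pi / 2) ≤ φ x) (h3 : θ x' ≤ (i + 1) * (Real.pi / 2))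
    (h4 : φ x' ≤ (i + 1) * (Real.pi / 2)) :
    (-1) ^ i * discriminant ε μ x' < (-1) ^ i * discriminant ε μ x := by
  have e := h.signed_discriminant_mul i x
  have e' := h.signed_discriminant_mul i x'
  have hp := h.cos_sub_pos x
  have hp' := h.cos_sub_pos x'
  rw [cos_sub_eq i] at hp hp'
  have hθ := h.strictMono_fst hx
  have hφ := h.strictMono_snd hx
  have hc1 : cos (θ x' - i * (Real.pi / 2)) < cos (θ x - i * (Real.pi / 2)) :=
    Real.cos_lt_cos_of_nonneg_of_le_pi_div_two (by linarith) (by linarith) (by linarith)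
  have hc2 : cos (φ x' - i * (Real.pi / 2)) < cos (φ x - i * (Real.pi / 2)) :=
    Real.cos_lt_cos_of_nonneg_of_le_pi_div_two (by linarith) (by linarith) (by linarith)
  have hs1 : sin (θ x - i * (Real.pi / 2)) < sin (θ x' - i * (Real.pi / 2)) :=
    Real.sin_lt_sin_of_lt_of_le_pi_div_two (by linarith) (by linarith) (by linarith)
  have hs2 : sin (φ x - i * (Real.pi / 2)) < sin (φ x' - i * (Real.pi / 2)) :=
    Real.sin_lt_sin_of_lt_of_le_pi_div_two (by linarith) (by linarith) (by linarith)
  have hc3 : 0 ≤ cos (θ x' - i * (Real.pi / 2)) :=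
    Real.cos_nonneg_of_mem_Icc ⟨by linarith, by linarith⟩
  have hc4 : 0 ≤ cos (φ x' - i * (Real.pi / 2)) :=
    Real.cos_nonneg_of_mem_Icc ⟨by linarith, by linarith⟩
  have hs3 : 0 ≤ sin (θ x - i * (Real.pi / 2)) :=
    Real.sin_nonneg_of_nonneg_of_le_pi (by linarith) (by linarith)
  have hs4 : 0 ≤ sin (φ x - i * (Real.pi / 2)) :=
    Real.sin_nonneg_of_nonneg_of_le_pi (by linarith) (by linarith)
  have hC := mul_lt_mul'' hc1 hc2 hc3 hc4
  have hS := mul_lt_mul'' hs1 hs2 hs3 hs4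
  have hC0 := mul_nonneg hc3 hc4
  have hS0 := mul_nonneg hs3 hs4
  set C := cos (θ x - i * (Real.pi / 2)) * cos (φ x - i * (Real.pi / 2))
  set C' := cos (θ x' - i * (Real.pi / 2)) * cos (φ x' - i * (Real.pi / 2))
  set S := sin (θ x - i * (Real.pi / 2)) * sin (φ x - i * (Real.pi / 2))
  set S' := sin (θ x' - i * (Real.pi / 2)) * sin (φ x' - i * (Real.pi / 2))
  rw [← eq_div_iff hp.ne'] at e
  rw [← eq_div_iff hp'.ne'] at e'
  rw [e, e', div_lt_div_iff₀ hp' hp]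
  have k1 : C' * S ≤ C * S := mul_le_mul_of_nonneg_right hC.le hS0
  have k2 : C * S < C * S' := mul_lt_mul_of_pos_left hS (hC0.trans_lt hC)
  nlinarith

lemma eq_of_isNthEnergy (h : IsAnglePair ε μ θ φ) {k : ℝ} {i : ℕ} {x x' : ℝ}
    (hx : IsNthEnergy ε μ θ φ k i x) (hx' : IsNthEnergy ε μ θ φ k i x') : x = x' := by
  by_contra hne
  rcases lt_or_gt_of_ne hne with hlt | hlt
  · have := h.signed_discriminant_lt hlt hx.fst_mem.1 hx.snd_mem.1 hx'.fst_mem.2 hx'.snd_mem.2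
    rw [hx.discriminant_eq, hx'.discriminant_eq] at this
    exact this.false
  · have := h.signed_discriminant_lt hlt hx'.fst_mem.1 hx'.snd_mem.1 hx.fst_mem.2 hx.snd_mem.2
    rw [hx.discriminant_eq, hx'.discriminant_eq] at this
    exact this.false

lemma exists_isNthEnergy (h : IsAnglePair ε μ θ φ) (i : ℕ) (k : ℝ) :
    ∃ x, IsNthEnergy ε μ θ φ k i x := by
  -- The extra π/2 makes φ, too, exceed the upper end of the quadrant at x'.
  obtain ⟨x', hx'⟩ := h.exists_le_fst ((i + 1) * (Real.pi / 2) + Real.pi / 2)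
  have hd' := abs_lt.1 (h.abs_sub_lt x')
  have hpi : 0 < Real.pi / 2 := by linarith [Real.pi_pos]
  have hi : (0 : ℝ) ≤ i * (Real.pi / 2) := mul_nonneg (Nat.cast_nonneg i) hpi.le
  have hminc : Continuous fun x => min (θ x) (φ x) := h.continuous_fst.min h.continuous_snd
  have hmaxc : Continuous fun x => max (θ x) (φ x) := h.continuous_fst.max h.continuous_snd
  -- Both angles are in the quadrant from u, where the smaller one enters, to w, where the larger
  -- one leaves. The signed discriminant is 1 at u and -1 at w, so it takes every value of ±cos k
  -- between.
  obtain ⟨u, -, hu⟩ := isPreconnected_univ.intermediate_value (mem_univ 0) (mem_univ x')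
    hminc.continuousOn (show (i : ℝ) * (Real.pi / 2) ∈ Icc _ _ from
      ⟨(min_le_left _ _).trans (by rw [h.fst_zero]; exact hi),
        le_min (by linarith) (by linarith)⟩)
  have hd := abs_lt.1 (h.abs_sub_lt u)
  have hmaxu : max (θ u) (φ u) < (i + 1) * (Real.pi / 2) := by
    simp only at hu
    rcases min_choice (θ u) (φ u) with hm | hm <;> rw [hm] at hu <;>
      exact max_lt (by linarith) (by linarith)
  obtain ⟨w, -, hw⟩ := isPreconnected_univ.intermediate_value (mem_univ u) (mem_univ x')
    hmaxc.continuousOn (show ((i : ℝ) + 1) * (Real.pi / 2) ∈ Icc _ _ from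
      ⟨hmaxu.le, le_max_of_le_left (by linarith)⟩)
  simp only at hu hw
  have huw : u ≤ w := by
    by_contra! hlt
    have := max_le_max (h.strictMono_fst hlt).le (h.strictMono_snd hlt).le
    linarith
  have eu : (-1) ^ i * discriminant ε μ u = 1 := by
    have e := h.signed_discriminant_mul i u
    have hp := h.cos_sub_pos u
    rw [cos_sub_eq i] at hp
    have h0 : sin (θ u - i * (Real.pi / 2)) * sin (φ u - i * (Real.pi / 2)) = 0 := by
      rcases min_choice (θ u) (φ u) with hm | hm <;> rw [hm] at hu <;> rw [hu, sub_self] <;> simp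
    rw [h0, add_zero] at e hp
    rw [sub_zero] at e
    exact mul_right_cancel₀ hp.ne' (by rw [e, one_mul])
  have ew : (-1) ^ i * discriminant ε μ w = -1 := by
    have e := h.signed_discriminant_mul i w
    have hp := h.cos_sub_pos w
    rw [cos_sub_eq i] at hp
    have h0 : cos (θ w - i * (Real.pi / 2)) * cos (φ w - i * (Real.pi / 2)) = 0 := by
      have hq : ((i : ℝ) + 1) * (Real.pi / 2) - i * (Real.pi / 2) = Real.pi / 2 := by ring
      rcases max_choice (θ w) (φ w) with hm | hm <;> rw [hm] at hw <;> rw [hw, hq] <;> simp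
    rw [h0, zero_add] at e hp
    rw [zero_sub] at e
    exact mul_right_cancel₀ hp.ne' (by rw [e]; ring)
  have hbound : |(-1) ^ i * cos k| ≤ 1 := by
    rw [abs_mul, abs_pow, abs_neg, abs_one, one_pow, one_mul]; exact Real.abs_cos_le_one k
  obtain ⟨x, hx, hxe⟩ := intermediate_value_Icc' huw
    ((continuous_const.mul h.continuous_discriminant).continuousOn (s := Icc u w))
    (show (-1) ^ i * cos k ∈ Icc ((-1) ^ i * discriminant ε μ w) ((-1) ^ i * discriminant ε μ u) by
      rw [eu, ew]; exact abs_le.1 hbound)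
  have hlo : (i : ℝ) * (Real.pi / 2) ≤ min (θ x) (φ x) := hu ▸
    min_le_min (h.strictMono_fst.monotone hx.1) (h.strictMono_snd.monotone hx.1)
  have hhi : max (θ x) (φ x) ≤ ((i : ℝ) + 1) * (Real.pi / 2) := hw ▸
    max_le_max (h.strictMono_fst.monotone hx.2) (h.strictMono_snd.monotone hx.2)
  exact ⟨x, ⟨hlo.trans (min_le_left _ _), (le_max_left _ _).trans hhi⟩,
    ⟨hlo.trans (min_le_right _ _), (le_max_right _ _).trans hhi⟩,
    mul_left_cancel₀ (pow_ne_zero i (by norm_num)) hxe⟩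

lemma quadrant_mul_le {i i' : ℕ} (hi : i < i') :
    ((i : ℝ) + 1) * (Real.pi / 2) ≤ i' * (Real.pi / 2) :=
  mul_le_mul_of_nonneg_right (by exact_mod_cast hi) (by linarith [Real.pi_pos])

lemma exists_isNthEnergy_of_lt (h : IsAnglePair ε μ θ φ) {k : ℝ} {i i' : ℕ} {x' : ℝ}
    (hx' : IsNthEnergy ε μ θ φ k i' x') (hi : i < i') :
    ∃ x ≤ x', IsNthEnergy ε μ θ φ k i x := by
  have hle := quadrant_mul_le hi
  obtain ⟨x, hx⟩ := h.exists_isNthEnergy i k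
  refine ⟨x, ?_, hx⟩
  exact h.strictMono_fst.le_iff_le.1 (hx.fst_mem.2.trans (hle.trans hx'.fst_mem.1))

lemma nonneg_of_isNthEnergy (h : IsAnglePair ε μ θ φ) {k : ℝ} {i : ℕ} {x : ℝ}
    (hx : IsNthEnergy ε μ θ φ k i x) : 0 ≤ x := by
  rw [← h.strictMono_fst.le_iff_le, h.fst_zero]
  exact (mul_nonneg (Nat.cast_nonneg i) (by linarith [Real.pi_pos])).trans hx.fst_mem.1

lemma exists_of_discriminant_eq (h : IsAnglePair ε μ θ φ) {k x : ℝ}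
    (hx : discriminant ε μ x = cos k) : ∃ i, IsNthEnergy ε μ θ φ k i x := by
  have hpi : 0 < Real.pi / 2 := by linarith [Real.pi_pos]
  have hc : |cos (θ x + φ x)| ≤ cos (θ x - φ x) := by
    rw [← h.discriminant_mul, hx, abs_mul, abs_of_pos (h.cos_sub_pos x)]
    exact mul_le_of_le_one_left (h.cos_sub_pos x).le (Real.abs_cos_le_one k)
  obtain ⟨i, h1, h2⟩ := exists_common_quadrant (h.abs_sub_lt x) hc
  -- Negative quadrants are impossible: φ > 0 for E ≤ 0, and θ > 0 for E > 0.
  have hi : 0 ≤ i := by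
    by_contra! hneg
    have hle : ((i : ℝ) + 1) * (Real.pi / 2) ≤ 0 :=
      mul_nonpos_of_nonpos_of_nonneg (by exact_mod_cast hneg) hpi.le
    have hx0 : 0 < x := by
      by_contra! hx0
      linarith [h.snd_pos x hx0, h2.2]
    have := h.strictMono_fst hx0
    rw [h.fst_zero] at this
    linarith [h1.2]
  lift i to ℕ using hi
  exact ⟨i, h1, h2, hx⟩

lemma eq_corner_of_lt {k x : ℝ} {i i' : ℕ} (hx : IsNthEnergy ε μ θ φ k i x)
    (hx' : IsNthEnergy ε μ θ φ k i' x) (hi : i < i') :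
    θ x = (i' : ℤ) * (Real.pi / 2) ∧ φ x = (i' : ℤ) * (Real.pi / 2) := by
  have hle := quadrant_mul_le hi
  rw [Int.cast_natCast]
  exact ⟨le_antisymm (hx.fst_mem.2.trans hle) hx'.fst_mem.1,
    le_antisymm (hx.snd_mem.2.trans hle) hx'.snd_mem.1⟩

/-- The eigenspace is two-dimensional exactly when both off-diagonal entries vanish. Then both
angles lie on axes, on the same one since they differ by less than π/2, and this corner belongs to
two adjacent quadrants. -/
lemma encard_isNthEnergy (hm : IsMaterial ε μ) (h : IsAnglePair ε μ θ φ) (k x : ℝ) :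
    {i | IsNthEnergy ε μ θ φ k i x}.encard = Module.finrank ℂ (blochSpace ε μ k x) := by
  have hpi : 0 < Real.pi / 2 := by linarith [Real.pi_pos]
  rw [finrank_blochSpace hm]
  have hdet := discriminant_sq_sub hm x
  by_cases hx : discriminant ε μ x = cos k
  · obtain ⟨i, hi⟩ := h.exists_of_discriminant_eq hx
    by_cases hcorner : upperEntry ε μ x = 0 ∧ lowerEntry ε μ x = 0
    · obtain ⟨n, hn⟩ := sin_mul_cos_eq_zero_iff.1 ((h.upperEntry_eq_zero x).1 hcorner.1)
      obtain ⟨m, hm'⟩ := sin_mul_cos_eq_zero_iff.1 ((h.lowerEntry_eq_zero x).1 hcorner.2)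
      have hmn : m = n := by
        have := h.abs_sub_lt x
        rw [hn, hm', ← sub_mul, abs_mul, abs_of_pos hpi] at this
        have h1 : |(m : ℝ) - n| < 1 := lt_of_mul_lt_mul_right (by rwa [one_mul]) hpi.le
        have h2 : |m - n| < 1 := by exact_mod_cast h1
        exact sub_eq_zero.1 (Int.abs_lt_one_iff.1 h2)
      subst hmn
      have hmpos : 0 < m := by
        have hφ : φ 0 ≤ φ x := h.strictMono_snd.monotone (h.nonneg_of_isNthEnergy hi)
        have : 0 < (m : ℝ) * (Real.pi / 2) := hn ▸ (h.snd_pos 0 le_rfl).trans_le hφ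
        exact_mod_cast pos_of_mul_pos_left this hpi.le
      obtain ⟨n, rfl⟩ : ∃ n : ℕ, m = n + 1 := ⟨(m - 1).toNat, by omega⟩
      have hset : {i | IsNthEnergy ε μ θ φ k i x} = {n, n + 1} := by
        have key : ∀ i : ℕ, IsNthEnergy ε μ θ φ k i x ↔ i = n ∨ i = n + 1 := by
          intro i
          constructor
          · intro hi
            have h1 := hi.fst_mem
            rw [hm'] at h1
            have h2 : (i : ℤ) ≤ n + 1 := by exact_mod_cast le_of_mul_le_mul_right h1.1 hpi
            have h3 : (n : ℤ) + 1 ≤ i + 1 := by exact_mod_cast le_of_mul_le_mul_right h1.2 hpi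
            omega
          · have hmem : ∀ i : ℕ, (i = n ∨ i = n + 1) → (((n : ℤ) + 1 : ℤ) : ℝ) * (Real.pi / 2) ∈
                Icc ((i : ℝ) * (Real.pi / 2)) ((i + 1) * (Real.pi / 2)) := by
              intro i hi
              constructor <;> refine mul_le_mul_of_nonneg_right ?_ hpi.le
              · have : (i : ℤ) ≤ n + 1 := by omega
                exact_mod_cast this
              · have : (n : ℤ) + 1 ≤ i + 1 := by omega
                exact_mod_cast this
            intro hi
            exact ⟨hm' ▸ hmem i hi, hn ▸ hmem i hi, hx⟩
        ext i
        simp [key]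
      rw [hset, encard_pair (by omega), hcorner.1, hcorner.2,
        finrank_multiplierSpace_eq_two (by rw [hcorner.1, zero_mul, sub_zero] at hdet; exact hdet) hx]
      rfl
    · have hset : {i | IsNthEnergy ε μ θ φ k i x} = {i} := by
        have key : ∀ {i i' : ℕ}, IsNthEnergy ε μ θ φ k i x → IsNthEnergy ε μ θ φ k i' x →
            ¬ i < i' := fun hi hi' hlt => by
          obtain ⟨h1, h2⟩ := eq_corner_of_lt hi hi' hlt
          exact hcorner ⟨(h.upperEntry_eq_zero x).2 (sin_mul_cos_eq_zero_iff.2 ⟨_, h2⟩),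
            (h.lowerEntry_eq_zero x).2 (sin_mul_cos_eq_zero_iff.2 ⟨_, h1⟩)⟩
        exact eq_singleton_iff_unique_mem.2 ⟨hi, fun i' hi' =>
          le_antisymm (not_lt.1 (key hi hi')) (not_lt.1 (key hi' hi))⟩
      rw [hset, encard_singleton, finrank_multiplierSpace_eq_one hdet hx (not_and_or.1 hcorner)]
      rfl
  · have hset : {i | IsNthEnergy ε μ θ φ k i x} = ∅ :=
      eq_empty_of_forall_notMem fun i hi => hx hi.discriminant_eq
    rw [hset, encard_empty, multiplierSpace_eq_bot hdet hx, finrank_bot]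
    rfl

/-- At each energy, basis indices are matched bijectively with quadrant indices. Since a quadrant
holds one eigenvalue at most, the matchings for different energies have disjoint images and combine
injectively. -/
lemma eigenvalueCount_eq (hm : IsMaterial ε μ) (h : IsAnglePair ε μ θ φ) (k E : ℝ) :
    eigenvalueCount ε μ k E = {i | ∃ x ≤ E, IsNthEnergy ε μ θ φ k i x}.encard := by
  have hex : ∀ x : ℝ, ∃ f : ℕ → ℕ, BijOn f (Iio (Module.finrank ℂ (blochSpace ε μ k x)))
      {i | IsNthEnergy ε μ θ φ k i x} := fun x =>
    (finite_Iio _).exists_bijOn_of_encard_eq (by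
      rw [encard_isNthEnergy hm h, ← Finset.coe_Iio, encard_coe_eq_coe_finsetCard, Nat.card_Iio])
  choose f hf using hex
  have himage : {i | ∃ x ≤ E, IsNthEnergy ε μ θ φ k i x} = (fun p : ℝ × ℕ => f p.1 p.2) ''
      {p : ℝ × ℕ | p.1 ≤ E ∧ p.2 < Module.finrank ℂ (blochSpace ε μ k p.1)} := by
    ext i
    constructor
    · rintro ⟨x, hx, hi⟩
      obtain ⟨n, hn, rfl⟩ := (hf x).surjOn hi
      exact ⟨(x, n), ⟨hx, hn⟩, rfl⟩
    · rintro ⟨p, ⟨hp, hn⟩, rfl⟩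
      exact ⟨p.1, hp, (hf p.1).mapsTo hn⟩
  rw [eigenvalueCount, himage, InjOn.encard_image]
  rintro ⟨x, n⟩ ⟨-, hn⟩ ⟨x', n'⟩ ⟨-, hn'⟩ heq
  dsimp only at hn hn' heq
  have h1 : IsNthEnergy ε μ θ φ k (f x n) x := (hf x).mapsTo hn
  have h2 : IsNthEnergy ε μ θ φ k (f x' n') x' := (hf x').mapsTo hn'
  rw [heq] at h1
  obtain rfl := h.eq_of_isNthEnergy h1 h2
  rw [(hf x).injOn hn hn' heq]

/-- Eigenvalues are ordered as their quadrants, so the indices counted form an initial segment of ℕ.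
The shift arises because quadrants are numbered from 0 and bands from 1. -/
lemma succ_le_eigenvalueCount_iff (hm : IsMaterial ε μ) (h : IsAnglePair ε μ θ φ) (n : ℕ)
    (k E : ℝ) : ((n + 1 : ℕ) : ℕ∞) ≤ eigenvalueCount ε μ k E ↔
      ∃ x ≤ E, IsNthEnergy ε μ θ φ k n x := by
  rw [eigenvalueCount_eq hm h]
  have hcard : ∀ m : ℕ, (Iio m).encard = m := fun m => by
    rw [← Finset.coe_Iio, encard_coe_eq_coe_finsetCard, Nat.card_Iio]
  constructor
  · intro hle
    by_contra hn
    have hsub : {i | ∃ x ≤ E, IsNthEnergy ε μ θ φ k i x} ⊆ Iio n := by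
      rintro i ⟨x, hx, hi⟩
      by_contra hni
      rw [mem_Iio, not_lt] at hni
      rcases hni.eq_or_lt with rfl | hlt
      · exact hn ⟨x, hx, hi⟩
      · obtain ⟨y, hy, hny⟩ := h.exists_isNthEnergy_of_lt hi hlt
        exact hn ⟨y, hy.trans hx, hny⟩
    have := hle.trans (encard_le_encard hsub)
    rw [hcard] at this
    have : n + 1 ≤ n := by exact_mod_cast this
    omega
  · rintro ⟨x, hx, hn⟩
    rw [← hcard]
    refine encard_le_encard fun i hi => ?_
    rcases (Nat.lt_succ_iff.1 hi).eq_or_lt with rfl | hlt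
    · exact ⟨x, hx, hn⟩
    · obtain ⟨y, hy, hiy⟩ := h.exists_isNthEnergy_of_lt hn hlt
      exact ⟨y, hy.trans hx, hiy⟩

lemma bandEnergy_eq (hm : IsMaterial ε μ) (h : IsAnglePair ε μ θ φ) {n : ℕ} {k x : ℝ}
    (hx : IsNthEnergy ε μ θ φ k n x) : bandEnergy ε μ (n + 1) k = x := by
  have : {E : ℝ | ((n + 1 : ℕ) : ℕ∞) ≤ eigenvalueCount ε μ k E} = Ici x := by
    ext E
    rw [mem_ofPred_eq, succ_le_eigenvalueCount_iff hm h]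
    exact ⟨fun ⟨y, hy, hny⟩ => h.eq_of_isNthEnergy hx hny ▸ hy, fun hE => ⟨x, hE, hx⟩⟩
  rw [bandEnergy, this, csInf_Ici]

lemma exists_isBlochMode (hm : IsMaterial ε μ) (h : IsAnglePair ε μ θ φ) {n : ℕ} {k x : ℝ}
    (hx : IsNthEnergy ε μ θ φ k n x) : ∃ ψ, IsBlochMode ε μ k x ψ := by
  have hcard := encard_isNthEnergy hm h k x
  have hne : blochSpace ε μ k x ≠ ⊥ := fun hbot => by
    rw [hbot, finrank_bot, Nat.cast_zero, encard_eq_zero] at hcard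
    exact (hcard ▸ hx : n ∈ (∅ : Set ℕ))
  obtain ⟨ψ, hψ, h0⟩ := Submodule.exists_mem_ne_zero_of_ne_bot hne
  exact ⟨ψ, hψ, h0⟩

end IsAnglePair

end Counting

/-! ### Band edges. -/

section BandEdges

variable {ε μ θ φ : ℝ → ℝ}

namespace IsAnglePair

/-- At the wavenumber `k` with `cos k = (-1)^j` the `j`-th band attains its maximum. -/
lemma bandMax_eq (hm : IsMaterial ε μ) (h : IsAnglePair ε μ θ φ) {m : ℕ} {k x : ℝ} (hk : k ∈ Icc (-Real.pi) Real.pi)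
    (hcos : cos k = (-1) ^ (m + 1)) (hx : IsNthEnergy ε μ θ φ k m x) :
    bandMax ε μ (m + 1) = x := by
  refine IsGreatest.csSup_eq ⟨⟨k, hk, h.bandEnergy_eq hm hx⟩, ?_⟩
  rintro _ ⟨k', -, rfl⟩
  obtain ⟨y, hy⟩ := h.exists_isNthEnergy m k'
  rw [h.bandEnergy_eq hm hy]
  by_contra! hlt
  -- At x the signed discriminant is -1, which no larger energy in the same quadrant could undercut.
  have := h.signed_discriminant_lt hlt hx.fst_mem.1 hx.snd_mem.1 hy.fst_mem.2 hy.snd_mem.2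
  rw [hx.discriminant_eq, hy.discriminant_eq, hcos, pow_succ, ← mul_assoc, ← mul_pow] at this
  have hb : |(-1) ^ m * cos k'| ≤ 1 := by
    rw [abs_mul, abs_pow, abs_neg, abs_one, one_pow, one_mul]; exact Real.abs_cos_le_one k'
  norm_num at this
  linarith [(abs_le.1 hb).1]

/-- At the wavenumber `k` with `cos k = (-1)^j` the `(j + 1)`-st band attains its minimum. -/
lemma bandMin_eq (hm : IsMaterial ε μ) (h : IsAnglePair ε μ θ φ) {m : ℕ} {k x : ℝ}
    (hk : k ∈ Icc (-Real.pi) Real.pi)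
    (hcos : cos k = (-1) ^ m) (hx : IsNthEnergy ε μ θ φ k m x) :
    bandMin ε μ (m + 1) = x := by
  refine IsLeast.csInf_eq ⟨⟨k, hk, h.bandEnergy_eq hm hx⟩, ?_⟩
  rintro _ ⟨k', -, rfl⟩
  obtain ⟨y, hy⟩ := h.exists_isNthEnergy m k'
  rw [h.bandEnergy_eq hm hy]
  by_contra! hlt
  have := h.signed_discriminant_lt hlt hy.fst_mem.1 hy.snd_mem.1 hx.fst_mem.2 hx.snd_mem.2
  rw [hx.discriminant_eq, hy.discriminant_eq, hcos, ← mul_pow] at this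
  have hb : |(-1) ^ m * cos k'| ≤ 1 := by
    rw [abs_mul, abs_pow, abs_neg, abs_one, one_pow, one_mul]; exact Real.abs_cos_le_one k'
  norm_num at this
  linarith [(abs_le.1 hb).2]

/-- At a band edge one of the two angles lies on an axis. -/
lemma sin_eq_zero_or (h : IsAnglePair ε μ θ φ) {j : ℕ} {x : ℝ}
    (hx : discriminant ε μ x = (-1) ^ j) :
    sin (θ x - j * (Real.pi / 2)) = 0 ∨ sin (φ x - j * (Real.pi / 2)) = 0 := by
  have e := h.signed_discriminant_mul j x
  rw [hx, ← mul_pow] at e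
  norm_num at e
  exact mul_eq_zero.1 (by linarith)

end IsAnglePair

lemma isMaterial_of_piecewiseContinuous (hε : PiecewiseContinuous ε) (hμ : PiecewiseContinuous μ)
    (hε_pos : ∀ x, 0 < ε x) (hμ_pos : ∀ x, 0 < μ x)
    (hε_per : ∀ x, ε (x + 1) = ε x) (hμ_per : ∀ x, μ (x + 1) = μ x)
    (hε_inv : ∀ x, ε (-x) = ε x) (hμ_inv : ∀ x, μ (-x) = μ x) : IsMaterial ε μ :=
  ⟨hε.isCoefficient hε_per, hμ.isCoefficient hμ_per, hε_pos, hμ_pos, hε_per, hμ_per, hε_inv, hμ_inv⟩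

end BandEdges

end Photonic

end

/-! ### Opposite parities across an open gap. -/

theorem mainTheorem4 (ε μ : ℝ → ℝ)
    (hε : Photonic.PiecewiseContinuous ε) (hμ : Photonic.PiecewiseContinuous μ)
    (hε_pos : ∀ x, 0 < ε x) (hμ_pos : ∀ x, 0 < μ x)
    (hε_per : ∀ x, ε (x + 1) = ε x) (hμ_per : ∀ x, μ (x + 1) = μ x)
    (hε_inv : ∀ x, ε (-x) = ε x) (hμ_inv : ∀ x, μ (-x) = μ x)
    (j : ℕ) (hj : 1 ≤ j) (hiso : Photonic.IsIsolatedBand ε μ j) :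
    (∃ k : ℝ, (k = 0 ∨ k = Real.pi) ∧
      Photonic.bandEnergy ε μ j k = Photonic.bandMax ε μ j ∧
      Photonic.bandEnergy ε μ (j + 1) k = Photonic.bandMin ε μ (j + 1) ∧
      (∃ φ, Photonic.IsBlochMode ε μ k (Photonic.bandMax ε μ j) φ) ∧
      (∃ φ, Photonic.IsBlochMode ε μ k (Photonic.bandMin ε μ (j + 1)) φ)) ∧
    ∀ k : ℝ, (k = 0 ∨ k = Real.pi) → ∀ φ₁ φ₂ : ℝ → ℂ,
      Photonic.IsBlochMode ε μ k (Photonic.bandMax ε μ j) φ₁ →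
      Photonic.IsBlochMode ε μ k (Photonic.bandMin ε μ (j + 1)) φ₂ →
        (Function.Even φ₁ ∧ Function.Odd φ₂) ∨ (Function.Odd φ₁ ∧ Function.Even φ₂) := by
  have hm := Photonic.isMaterial_of_piecewiseContinuous hε hμ hε_pos hμ_pos hε_per hμ_per
    hε_inv hμ_inv
  obtain ⟨θ, φ, h⟩ := Photonic.exists_isAnglePair hm
  obtain ⟨m, rfl⟩ : ∃ m, j = m + 1 := ⟨j - 1, by omega⟩
  have hpi := Real.pi_pos
  have hgap := hiso.2
  obtain ⟨k₀, hk₀, hcos⟩ : ∃ k : ℝ, (k = 0 ∨ k = Real.pi) ∧ Real.cos k = (-1) ^ (m + 1) := by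
    rcases Nat.even_or_odd (m + 1) with he | ho
    · exact ⟨0, Or.inl rfl, by rw [he.neg_one_pow, Real.cos_zero]⟩
    · exact ⟨Real.pi, Or.inr rfl, by rw [ho.neg_one_pow, Real.cos_pi]⟩
  have hk₀' : k₀ ∈ Icc (-Real.pi) Real.pi := by
    rcases hk₀ with rfl | rfl <;> constructor <;> linarith
  obtain ⟨x, hx⟩ := h.exists_isNthEnergy m k₀
  obtain ⟨x', hx'⟩ := h.exists_isNthEnergy (m + 1) k₀
  have hbmax := h.bandMax_eq hm hk₀' hcos hx
  have hbmin := h.bandMin_eq hm hk₀' hcos hx'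
  rw [hbmax, hbmin] at hgap ⊢
  refine ⟨⟨k₀, hk₀, h.bandEnergy_eq hm hx, h.bandEnergy_eq hm hx', h.exists_isBlochMode hm hx,
    h.exists_isBlochMode hm hx'⟩, fun k hk φ₁ φ₂ h₁ h₂ => ?_⟩
  have hsin : Real.sin k = 0 := by rcases hk with rfl | rfl <;> simp
  have hθ := h.strictMono_fst hgap
  have hφ := h.strictMono_snd hgap
  have hd := abs_lt.1 (h.abs_sub_lt x)
  have hd' := abs_lt.1 (h.abs_sub_lt x')
  obtain ⟨⟨a1, a2⟩, ⟨a3, a4⟩, ha⟩ := hx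
  obtain ⟨⟨b1, b2⟩, ⟨b3, b4⟩, hb⟩ := hx'
  have hzero : ∀ {t : ℝ}, -Real.pi < t → t < Real.pi → Real.sin t = 0 → t = 0 :=
    fun h1 h2 h3 => (Real.sin_eq_zero_iff_of_lt_of_lt h1 h2).1 h3
  push_cast at a1 a2 a3 a4 b1 b2 b3 b4
  have e := h.sin_eq_zero_or (ha.trans hcos)
  have e' := h.sin_eq_zero_or (hb.trans hcos)
  push_cast at e e'
  -- An angle strictly inside a quadrant makes the corresponding off-diagonal entry nonzero, which
  -- fixes the parity.
  have hodd : ∀ {n : ℕ} {y ψ}, Photonic.IsBlochMode ε μ k y ψ → n * (Real.pi / 2) < θ y →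
      θ y < (n + 1) * (Real.pi / 2) → Function.Odd ψ := fun {n y ψ} hψ h1 h2 =>
    hψ.odd hm hsin ((h.lowerEntry_eq_zero y).not.2
      (Photonic.sin_mul_cos_ne_zero (n := n) (by exact_mod_cast h1) (by exact_mod_cast h2)))
  have heven : ∀ {n : ℕ} {y ψ}, Photonic.IsBlochMode ε μ k y ψ → n * (Real.pi / 2) < φ y →
      φ y < (n + 1) * (Real.pi / 2) → Function.Even ψ := fun {n y ψ} hψ h1 h2 =>
    hψ.even hm hsin ((h.upperEntry_eq_zero y).not.2
      (Photonic.sin_mul_cos_ne_zero (n := n) (by exact_mod_cast h1) (by exact_mod_cast h2)))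
  -- The cases record which angle equals (m+1)π/2 at each edge. The same angle twice contradicts
  -- strict growth across the gap. Otherwise the other angle is strictly inside its quadrant: that
  -- growth keeps it off the shared axis, and |θ - φ| < π/2 off the far one.
  rcases e with e | e <;> rcases e' with e' | e' <;>
    have z := hzero (by linarith) (by linarith) e <;>
    have z' := hzero (by linarith) (by linarith) e'
  · exfalso; linarith
  · refine Or.inl ⟨heven (n := m) h₁ ?_ ?_, hodd (n := m + 1) h₂ ?_ ?_⟩ <;> push_cast <;> linarith
  · refine Or.inr ⟨hodd (n := m) h₁ ?_ ?_, heven (n := m + 1) h₂ ?_ ?_⟩ <;> push_cast <;> linarith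
  · exfalso; linarith
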